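/- Let $q\in\mathbb R\setminus\{0,1,-1\}$, fix a square root $q^{1/2}\in\mathbb C$, put $\hat q=q-q^{-1}$, $[2]=q+q^{-1}$; all indices run over $\{1,2\}$ and repeated indices are summed. Let $\hat R^{ij}_{kl}=q^{-1/2}\bigl(q^{\delta_{ij}}\delta_{il}\delta_{jk}+\hat q\,\delta_{i1}\delta_{k1}\delta_{j2}\delta_{l2}\bigr)$, $\check C^{12}=q^{-1/2}$, $\check C^{21}=-q^{1/2}$, $\check C^{11}=\check C^{22}=0$, $\hat C_{ij}=-\check C^{ij}$; $\hat R^{-1}$ is the inverse matrix of $\hat R$. *Algebra and calculus.* $\mathcal A=\mathcal O(SL_q(2))$ is the algebra with generators $u^i_j$ and relations $\hat R^{ij}_{kl}u^k_mu^l_n=u^i_ku^j_l\hat R^{kl}_{mn}$, $u^1_1u^2_2-qu^1_2u^2_1=1$, with $\Delta u^i_j=u^i_k\otimes u^k_j$, $\varepsilon(u^i_j)=\delta_{ij}$, Haar functional $h$ (the normalized bi-invariant functional), and with one of the involutions $(u^1_1)^*=u^2_2$, $(u^1_2)^*=-\kappa q\,u^2_1$, $\kappa\in\{1,-1\}$ ($SU_q(2)$,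 $SU_q(1,1)$). For a sign $\nu_0$ let $\Gamma$ be the bicovariant $4D_\pm$-calculus: the $\mathcal A$-bimodule that is free as a left module on $\theta_{ij}$, with $\theta_{ij}u^k_l=\nu_0\hat R^{mr}_{it}(\hat R^{-1})^{ts}_{jl}u^k_m\theta_{rs}$, $\theta=q^{1/2}\hat q^{-1}\check C^{ij}\theta_{ij}$, $da=\theta a-a\theta$, and $\theta_{11}^*=\kappa q^{-1}\theta_{22}$, $\theta_{22}^*=\kappa q\,\theta_{11}$, $\theta_{12}^*=-\theta_{12}$, $\theta_{21}^*=-\theta_{21}$, $(a\rho b)^*=b^*\rho^*a^*$. *Clifford algebra and spinors.* Let $\sigma(\theta_{mn}\otimes\theta_{rs})=(\hat R_{23}\hat R_{12}\hat R^{-1}_{34}\hat R^{-1}_{23})^{ijkl}_{mnrs}\theta_{ij}\otimes\theta_{kl}$ and $g(\theta_{ij}\otimes\theta_{kl})=-q^{1/2}c_1\hat C_{im}\hat C_{nl}(\hat R^{-1})^{mn}_{jk}$ (with $c_1\in\mathbb R\setminus\{0\}$) be the braiding and the $\sigma$-metric on $\Gamma\otimes_{\mathcal A}\Gamma$, and let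 $\mathrm{Cl}=\mathrm{Cl}(\Gamma,\sigma,g)$ be the quotient of the tensor algebra of the bimodule $\Gamma$ over $\mathcal A$ by the relations $x=g(x)$ for $x\in\ker(\mathrm{id}-\sigma)$. Let $\mathcal S_0\subset\mathrm{Cl}$ be the left ideal generated by $\psi^+_1=\frac{q}{[2]c_1}\theta_{11}\theta_{12}\theta_{21}\theta_{22}$, $\psi^+_2=\theta_{21}\theta_{22}$, $\psi^-_1=\theta_{11}\theta_{21}\theta_{22}$, $\psi^-_2=q\,\theta_{12}\theta_{21}\theta_{22}$. *Metric.* Let $\langle\cdot,\cdot\rangle=h\circ\langle\cdot,\cdot\rangle_0$ be a hermitean non-degenerate metric on $\mathcal S_0$, where $\langle\cdot,\cdot\rangle_0:\mathcal S_0\times\mathcal S_0\to\mathcal A$ is linear in the first and antilinear in the second argument, $\langle a\varphi,b\psi\rangle_0=a\langle\varphi,\psi\rangle_0b^*$ for $a,b\in\mathcal A$, $\langle\psi^{\epsilon}_i,\psi^{\epsilon'}_j\rangle_0\in\mathbb C$ for all signs $\epsilon,\epsilon'$ and all $i,j$ (left-covariance), and $\langle\theta_{ij}\varphi,\psi\rangle=\langle\varphi,\beta(\theta_{ij})\psi\rangle$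 with $\beta(\theta_{11})=-\kappa q^{-3}\theta_{22}$, $\beta(\theta_{22})=-\kappa q^3\theta_{11}$, $\beta(\theta_{12})=\theta_{12}$, $\beta(\theta_{21})=\theta_{21}$. *Connection.* Let $\gamma\in\mathbb R$, $\eta\in\{1,-1\}$, and let $\nabla_{\mathcal S}:\mathcal S_0\to\Gamma\otimes_{\mathcal A}\mathcal S_0$ be the left connection, $\nabla_{\mathcal S}(a\psi)=da\otimes\psi+a\nabla_{\mathcal S}\psi$, with $\nabla_{\mathcal S}\psi^\pm_m=\theta\otimes\psi^\pm_m-\tau(\psi^\pm_m\otimes\theta)$, where $$\tau(\psi^+_m\otimes\theta_{jk})=\gamma q^{j+k}\hat R^{st}_{lk}(\hat R^{\eta})^{rl}_{mj}\,\theta_{rs}\otimes\psi^+_t,\qquad \tau(\psi^-_m\otimes\theta_{jk})=\gamma q^{j+k}(\hat R^{\eta})^{st}_{lk}(\hat R^{-1})^{rl}_{mj}\,\theta_{rs}\otimes\psi^-_t .$$ Let $D:\mathcal S_0\to\mathcal S_0$ be its Dirac operator, i.e. $\nabla_{\mathcal S}$ followed by the multiplication $\Gamma\otimes_{\mathcal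 A}\mathcal S_0\to\mathcal S_0$, $\rho\otimes\varphi\mapsto\rho\varphi$. **Theorem.** There is exactly one linear map $\nabla^*\nabla_{\mathcal S}:\mathcal S_0\to\mathcal S_0$ (the connection Laplacian) with $\langle\nabla^*\nabla_{\mathcal S}\psi,\psi'\rangle=-h\bigl(g(\langle\nabla_{\mathcal S}\psi,\nabla_{\mathcal S}\psi'\rangle_0)\bigr)$ for all $\psi,\psi'\in\mathcal S_0$, where $\langle\rho\otimes\varphi,\rho'\otimes\varphi'\rangle_0=\rho\otimes\langle\varphi,\varphi'\rangle_0\,\rho'^*$, and $$(q+1)D^2-q^{\frac12-\frac32\eta}[2]\,\nabla^*\nabla_{\mathcal S}=\eta\,q^{-\eta-1}[2]\,c_1\,\frac{q^3-1}{\hat q}\,\frac{q^6\gamma^2-1}{\hat q}\;\mathrm{id}.$$ This operator is an invariant differential operator of order zero on $\mathcal S_0$. Here a linear map $\partial$ on $\mathcal S_0$ is an invariant differential operator of order $m$ if $\partial(a\psi_I)=a_{(1)}p_{JI}(a_{(2)})\psi_J$ (where $\psi_I,\psi_J$ run over the four elements $\psi^\pm_i$) with functionals $p_{JI}$ of degree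 at most $m$ in the unital algebra generated by the functionals $X_{kl}$ given by $da=a_{(1)}X_{kl}(a_{(2)})\theta_{kl}$, and if $\partial$ commutes with the right coaction $a\psi^\pm_i\mapsto a_{(1)}\psi^\pm_j\otimes a_{(2)}u^j_i\chi$ of $\mathcal A\rtimes\mathbb C[\chi,\chi^{-1}]$. -/

import Mathlib

open scoped TensorProduct

noncomputable section

namespace QSL

/-- Pairs of indices.  The index values `1, 2` of the mathematics are `0, 1 : Fin 2` here. -/
abbrev I2 := Fin 2 × Fin 2

/-- The standing data: a real number `q` different from `0, 1, -1`, a fixed square root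
`s = q^(1/2)`, the real parameter `c₁ ≠ 0` of the bicovariant `σ`-metric, the sign `ν₀` of the
`4D_±`-calculus, and the sign `κ` that selects the involution: `κ = 1` is the one of `SU_q(2)`,
`κ = -1` the one of `SU_q(1,1)`. -/
structure Data where
  q : ℝ
  s : ℂ
  c₁ : ℝ
  ν₀ : ℤˣ
  κ : ℤˣ
  s_sq : s ^ 2 = (q : ℂ)
  q_ne_zero : q ≠ 0
  q_ne_one : q ≠ 1
  q_ne_neg_one : q ≠ -1
  c₁_ne_zero : c₁ ≠ 0

variable (P : Data)

/-- `q` as a complex number. -/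
def qc : ℂ := (P.q : ℂ)

/-- `q̂ = q - q⁻¹`. -/
def qhat : ℂ := qc P - (qc P)⁻¹

/-- `[2] = q + q⁻¹`. -/
def two : ℂ := qc P + (qc P)⁻¹

/-- The matrix `R̂^{ij}_{kl}`. -/
def R (i j k l : Fin 2) : ℂ :=
  (if i = l ∧ j = k then (if i = j then qc P else 1) * P.s⁻¹ else 0) +
    (if i = 0 ∧ k = 0 ∧ j = 1 ∧ l = 1 then P.s⁻¹ * qhat P else 0)

/-- `Č^{ij}`. -/
def Cup (i j : Fin 2) : ℂ :=
  (if i = 0 ∧ j = 1 then P.s⁻¹ else 0) - (if i = 1 ∧ j = 0 then P.s else 0)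

/-- `Ĉ_{ij} = -Č^{ij}`. -/
def Cap (i j : Fin 2) : ℂ := -Cup P i j

/-- The inverse matrix of `R̂`; see `R_mul_Rinv`. -/
def Rinv (i j k l : Fin 2) : ℂ :=
  (if i = k ∧ j = l then P.s⁻¹ else 0) + P.s * Cup P i j * Cap P k l

/-- `R̂^η` for a sign `η`. -/
def Rpow (η : ℤˣ) (i j k l : Fin 2) : ℂ := if η = 1 then R P i j k l else Rinv P i j k l

theorem qc_ne : qc P ≠ 0 := by
  simpa [qc] using P.q_ne_zero

theorem s_ne : P.s ≠ 0 := by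
  intro h
  have := P.s_sq
  rw [h] at this
  exact qc_ne P (by simpa [qc] using this.symm)

theorem s_sq' : P.s ^ 2 = qc P := P.s_sq

theorem qc_eq : qc P = P.s ^ 2 := P.s_sq.symm

theorem R_mul_Rinv (i j k l : Fin 2) :
    ∑ a, ∑ b, R P i j a b * Rinv P a b k l = if i = k ∧ j = l then 1 else 0 := by
  have hs := s_ne P
  fin_cases i <;> fin_cases j <;> fin_cases k <;> fin_cases l <;>
    simp [R, Rinv, Cup, Cap, qhat, qc_eq] <;> field_simp <;> ring_nf <;> try simp

/-! ### The Hopf `*`-algebra `O(SL_q(2))` -/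

/-- The `2 × 2` matrix `x` over the algebra `B` satisfies the defining relations
`R̂ x₁ x₂ = x₁ x₂ R̂` and `x¹₁ x²₂ - q x¹₂ x²₁ = 1` of `O(SL_q(2))`. -/
structure IsQMat {B : Type*} [Ring B] [Algebra ℂ B] (x : Fin 2 → Fin 2 → B) : Prop where
  rel : ∀ i j m n, ∑ k, ∑ l, R P i j k l • (x k m * x l n) =
    ∑ k, ∑ l, R P k l m n • (x i k * x j l)
  det : x 0 0 * x 1 1 - qc P • (x 0 1 * x 1 0) = 1

/-- The defining relations of `O(SL_q(2))` on the free algebra on `u^i_j`. -/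
inductive ARel : FreeAlgebra ℂ I2 → FreeAlgebra ℂ I2 → Prop
  | rel (i j m n : Fin 2) : ARel
      (∑ k, ∑ l, R P i j k l • (FreeAlgebra.ι ℂ (k, m) * FreeAlgebra.ι ℂ (l, n)))
      (∑ k, ∑ l, R P k l m n • (FreeAlgebra.ι ℂ (i, k) * FreeAlgebra.ι ℂ (j, l)))
  | det : ARel
      (FreeAlgebra.ι ℂ (0, 0) * FreeAlgebra.ι ℂ (1, 1) -
        qc P • (FreeAlgebra.ι ℂ (0, 1) * FreeAlgebra.ι ℂ (1, 0))) 1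

/-- The algebra `𝒜 = O(SL_q(2))`. -/
def A : Type := RingQuot (ARel P)

instance instRingA : Ring (A P) := inferInstanceAs (Ring (RingQuot (ARel P)))

instance instAlgebraA : Algebra ℂ (A P) := inferInstanceAs (Algebra ℂ (RingQuot (ARel P)))

/-- The canonical projection of the free algebra onto `𝒜`. -/
def mkA : FreeAlgebra ℂ I2 →ₐ[ℂ] A P := RingQuot.mkAlgHom ℂ (ARel P)

theorem mkA_rel {x y : FreeAlgebra ℂ I2} (h : ARel P x y) : mkA P x = mkA P y :=
  RingQuot.mkAlgHom_rel ℂ h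

/-- The generators `u^i_j`. -/
def u (i j : Fin 2) : A P := mkA P (FreeAlgebra.ι ℂ (i, j))

theorem u_isQMat : IsQMat P (u P) where
  rel i j m n := by
    have h := mkA_rel P (ARel.rel i j m n)
    simpa only [map_sum, map_smul, map_mul, u] using h
  det := by
    have h := mkA_rel P ARel.det
    simpa only [map_sub, map_smul, map_mul, map_one, u] using h

variable {P} in
/-- The universal property of `O(SL_q(2))`. -/
def liftA {B : Type*} [Ring B] [Algebra ℂ B] {x : Fin 2 → Fin 2 → B} (hx : IsQMat P x) :
    A P →ₐ[ℂ] B :=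
  RingQuot.liftAlgHom ℂ ⟨FreeAlgebra.lift ℂ (fun I : I2 => x I.1 I.2), by
    intro a b h
    cases h with
    | rel i j m n => simpa using hx.rel i j m n
    | det => simpa using hx.det⟩

variable {P} in
@[simp]
theorem liftA_u {B : Type*} [Ring B] [Algebra ℂ B] {x : Fin 2 → Fin 2 → B} (hx : IsQMat P x)
    (i j : Fin 2) : liftA hx (u P i j) = x i j := by
  refine (RingQuot.liftAlgHom_mkAlgHom_apply ℂ _ _ _).trans ?_
  simp

theorem IsQMat.basic {B : Type*} [Ring B] [Algebra ℂ B] {x : Fin 2 → Fin 2 → B}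
    (hx : IsQMat P x) :
    x 0 0 * x 0 1 = qc P • (x 0 1 * x 0 0) ∧ x 0 0 * x 1 0 = qc P • (x 1 0 * x 0 0) ∧
    x 0 1 * x 1 1 = qc P • (x 1 1 * x 0 1) ∧ x 1 0 * x 1 1 = qc P • (x 1 1 * x 1 0) ∧
    x 0 1 * x 1 0 = x 1 0 * x 0 1 ∧
    x 0 0 * x 1 1 = x 1 1 * x 0 0 + qhat P • (x 0 1 * x 1 0) := by
  have hs := s_ne P
  have hq := qc_ne P
  have key : ∀ {y z : B}, P.s⁻¹ • y = P.s⁻¹ • z → y = z := by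
    intro y z h
    have := congrArg (fun t => P.s • t) h
    simpa [smul_smul, hs] using this
  refine ⟨?_, ?_, ?_, ?_, ?_, ?_⟩
  · have h := hx.rel 0 0 1 0
    simp [R, Fin.sum_univ_two] at h
    apply key
    rw [← h, smul_smul, mul_comm]
  · have h := hx.rel 1 0 0 0
    simp [R, Fin.sum_univ_two] at h
    apply key
    rw [h, smul_smul, mul_comm]
  · have h := hx.rel 1 0 1 1
    simp [R, Fin.sum_univ_two] at h
    apply key
    rw [h, smul_smul, mul_comm]
  · have h := hx.rel 1 1 1 0
    simp [R, Fin.sum_univ_two] at h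
    apply key
    rw [← h, smul_smul, mul_comm]
  · have h := hx.rel 0 1 0 1
    simp [R, Fin.sum_univ_two] at h
    apply key
    exact h.symm
  · have h := hx.rel 0 1 1 0
    simp [R, Fin.sum_univ_two] at h
    apply key
    rw [← h, smul_add, smul_smul, add_comm]

theorem isQMat_of_basic {B : Type*} [Ring B] [Algebra ℂ B] {x : Fin 2 → Fin 2 → B}
    (h1 : x 0 0 * x 0 1 = qc P • (x 0 1 * x 0 0)) (h2 : x 0 0 * x 1 0 = qc P • (x 1 0 * x 0 0))
    (h3 : x 0 1 * x 1 1 = qc P • (x 1 1 * x 0 1)) (h4 : x 1 0 * x 1 1 = qc P • (x 1 1 * x 1 0))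
    (h5 : x 0 1 * x 1 0 = x 1 0 * x 0 1)
    (h6 : x 0 0 * x 1 1 = x 1 1 * x 0 0 + qhat P • (x 0 1 * x 1 0))
    (hd : x 0 0 * x 1 1 - qc P • (x 0 1 * x 1 0) = 1) : IsQMat P x where
  rel i j m n := by
    have hs := s_ne P
    fin_cases i <;> fin_cases j <;> fin_cases m <;> fin_cases n <;>
      simp [R, Fin.sum_univ_two] <;>
      simp only [h1, h2, h3, h4, h5, h6, qhat, qc_eq, smul_add, smul_smul] <;>
      match_scalars <;> field_simp <;> ring
  det := hd

theorem IsQMat.map {B B' : Type*} [Ring B] [Algebra ℂ B] [Ring B'] [Algebra ℂ B']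
    {x : Fin 2 → Fin 2 → B} (hx : IsQMat P x) (F : B →ₐ[ℂ] B') :
    IsQMat P (fun i j => F (x i j)) where
  rel i j m n := by
    simpa only [map_sum, map_smul, map_mul] using congrArg F (hx.rel i j m n)
  det := by
    simpa only [map_sub, map_smul, map_mul, map_one] using congrArg F hx.det

/-- The product of two mutually commuting matrices that satisfy the relations of `O(SL_q(2))`
satisfies them, too. -/
theorem IsQMat.mul {B : Type*} [Ring B] [Algebra ℂ B] {x y : Fin 2 → Fin 2 → B}
    (hx : IsQMat P x) (hy : IsQMat P y) (hxy : ∀ i j k l, Commute (x i j) (y k l)) :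
    IsQMat P (fun i j => ∑ k, x i k * y k j) where
  rel i j m n := by
    have e : ∀ a b c d e f : Fin 2, (x a b * y b c) * (x d e * y e f) =
        (x a b * x d e) * (y b c * y e f) := by
      intro a b c d e f
      rw [mul_assoc, ← mul_assoc (y b c), ← (hxy d e b c).eq]
      simp only [mul_assoc]
    have hl : ∀ a b, (∑ k, ∑ l, R P i j k l • (x k a * x l b)) * (y a m * y b n) =
        (∑ k, ∑ l, R P k l a b • (x i k * x j l)) * (y a m * y b n) := by
      intro a b
      rw [hx.rel]
    have hr : ∀ a b, (x i a * x j b) * (∑ k, ∑ l, R P a b k l • (y k m * y l n)) =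
        (x i a * x j b) * (∑ k, ∑ l, R P k l m n • (y a k * y b l)) := by
      intro a b
      rw [hy.rel]
    have hl' := Finset.sum_congr rfl (fun a (_ : a ∈ (Finset.univ : Finset (Fin 2))) =>
      Finset.sum_congr rfl (fun b (_ : b ∈ (Finset.univ : Finset (Fin 2))) => hl a b))
    have hr' := Finset.sum_congr rfl (fun a (_ : a ∈ (Finset.univ : Finset (Fin 2))) =>
      Finset.sum_congr rfl (fun b (_ : b ∈ (Finset.univ : Finset (Fin 2))) => hr a b))
    simp only [Fin.sum_univ_two, add_mul, mul_add, smul_add, smul_mul_assoc, mul_smul_comm, e]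
      at hl' hr' ⊢
    linear_combination (norm := module) hl' + hr'
  det := by
    have hq := qc_ne P
    obtain ⟨h1, -, -, h4, h5, h6⟩ := hy.basic
    have hd := hy.det
    have hdx := hx.det
    have e : ∀ a b c d e f : Fin 2, (x a b * y b c) * (x d e * y e f) =
        (x a b * x d e) * (y b c * y e f) := by
      intro a b c d e f
      rw [mul_assoc, ← mul_assoc (y b c), ← (hxy d e b c).eq]
      simp only [mul_assoc]
    have k1 : y 0 0 * y 0 1 - qc P • (y 0 1 * y 0 0) = 0 := by rw [h1, sub_self]
    have k2 : y 1 0 * y 1 1 - qc P • (y 1 1 * y 1 0) = 0 := by rw [h4, sub_self]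
    have k3 : y 1 0 * y 0 1 - qc P • (y 1 1 * y 0 0) = -(qc P • (1 : B)) := by
      rw [← hd, h6, ← h5, qhat]
      match_scalars <;> field_simp <;> ring
    simp only [Fin.sum_univ_two, add_mul, mul_add, smul_add, e]
    have : (x 0 0 * x 1 0) * (y 0 0 * y 0 1 - qc P • (y 0 1 * y 0 0)) +
        (x 0 1 * x 1 1) * (y 1 0 * y 1 1 - qc P • (y 1 1 * y 1 0)) +
        (x 0 0 * x 1 1) * (y 0 0 * y 1 1 - qc P • (y 0 1 * y 1 0)) +
        (x 0 1 * x 1 0) * (y 1 0 * y 0 1 - qc P • (y 1 1 * y 0 0)) = 1 := by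
      rw [k1, k2, hd, k3]
      simp only [mul_zero, mul_one, mul_neg, mul_smul_comm]
      rw [← hdx]
      abel
    rw [← this]
    simp only [mul_sub, mul_smul_comm]
    abel

/-- The coproduct `Δ u^i_j = u^i_k ⊗ u^k_j`. -/
def comul : A P →ₐ[ℂ] A P ⊗[ℂ] A P :=
  liftA (IsQMat.mul P
    ((u_isQMat P).map P (Algebra.TensorProduct.includeLeft : A P →ₐ[ℂ] A P ⊗[ℂ] A P))
    ((u_isQMat P).map P (Algebra.TensorProduct.includeRight : A P →ₐ[ℂ] A P ⊗[ℂ] A P))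
    (fun i j k l => by simp [Commute, SemiconjBy]))

theorem comul_u (i j : Fin 2) : comul P (u P i j) = ∑ k, u P i k ⊗ₜ[ℂ] u P k j := by
  simp [comul]

/-- The counit `ε (u^i_j) = δ_ij`. -/
def counit : A P →ₐ[ℂ] ℂ :=
  liftA (P := P) (x := fun i j => if i = j then 1 else 0)
    (isQMat_of_basic P (by simp) (by simp) (by simp) (by simp) (by simp) (by simp) (by simp))

/-- The opposite algebra of `B` with the complex conjugate scalar multiplication. -/
def ConjOp (B : Type*) : Type _ := Bᵐᵒᵖ

instance {B : Type*} [Ring B] : Ring (ConjOp B) := inferInstanceAs (Ring Bᵐᵒᵖ)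

instance {B : Type*} [Ring B] [Algebra ℂ B] : Algebra ℂ (ConjOp B) :=
  RingHom.toAlgebra'
    { toFun := fun c => (MulOpposite.op (algebraMap ℂ B ((starRingEnd ℂ) c)) : Bᵐᵒᵖ)
      map_one' := by rw [map_one, map_one]; rfl
      map_mul' := fun c d => by rw [map_mul, map_mul, (Algebra.commutes _ _)]; rfl
      map_zero' := by rw [map_zero, map_zero]; rfl
      map_add' := fun c d => by rw [map_add, map_add]; rfl }
    (fun c x => congrArg MulOpposite.op
      (Algebra.commutes ((starRingEnd ℂ) c) (MulOpposite.unop x)).symm)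

/-- `B → ConjOp B`, the identity on elements. -/
def ConjOp.mk {B : Type*} (b : B) : ConjOp B := MulOpposite.op b

/-- `ConjOp B → B`, the identity on elements. -/
def ConjOp.un {B : Type*} (b : ConjOp B) : B := MulOpposite.unop b

theorem ConjOp.mk_mul {B : Type*} [Ring B] (a b : B) :
    ConjOp.mk a * ConjOp.mk b = ConjOp.mk (b * a) := rfl

theorem ConjOp.mk_add {B : Type*} [Ring B] (a b : B) :
    ConjOp.mk a + ConjOp.mk b = ConjOp.mk (a + b) := rfl

theorem ConjOp.mk_sub {B : Type*} [Ring B] (a b : B) :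
    ConjOp.mk a - ConjOp.mk b = ConjOp.mk (a - b) := rfl

theorem ConjOp.smul_mk {B : Type*} [Ring B] [Algebra ℂ B] (c : ℂ) (b : B) :
    c • ConjOp.mk b = ConjOp.mk ((starRingEnd ℂ) c • b) := by
  rw [Algebra.smul_def, Algebra.smul_def, Algebra.commutes]
  rfl

/-- The coefficients of the involution: `(u^1_1)^* = u^2_2`, `(u^1_2)^* = -κ q u^2_1`,
`(u^2_1)^* = -κ q⁻¹ u^1_2`, `(u^2_2)^* = u^1_1`. -/
def starCoef (i j : Fin 2) : ℂ :=
  if i = j then 1 else if i = 0 then -((P.κ : ℤ) : ℂ) * qc P else -((P.κ : ℤ) : ℂ) * (qc P)⁻¹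

theorem conj_qc : (starRingEnd ℂ) (qc P) = qc P := Complex.conj_ofReal _

theorem kappa_sq : ((P.κ : ℤ) : ℂ) * ((P.κ : ℤ) : ℂ) = 1 := by
  rcases Int.units_eq_one_or P.κ with h | h <;> simp [h]

theorem star_isQMat : IsQMat P (B := ConjOp (A P))
    (fun i j => ConjOp.mk (starCoef P i j • u P (1 - i) (1 - j))) := by
  obtain ⟨h1, h2, h3, h4, h5, h6⟩ := (u_isQMat P).basic
  have hd := (u_isQMat P).det
  have hq := qc_ne P
  have hk := kappa_sq P
  have h01 : ¬ ((0 : Fin 2) = 1) := by decide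
  have h10 : ¬ ((1 : Fin 2) = 0) := by decide
  have hkk : -((P.κ : ℤ) : ℂ) * qc P * (-((P.κ : ℤ) : ℂ) * (qc P)⁻¹) = 1 := by
    field_simp
    rw [sq, hk]
  apply isQMat_of_basic <;>
    simp only [ConjOp.mk_mul, ConjOp.mk_add, ConjOp.mk_sub, ConjOp.smul_mk, starCoef, conj_qc,
      qhat, map_sub, map_inv₀, sub_zero, sub_self, if_true, if_false, h01, h10, one_smul,
      smul_mul_assoc, mul_smul_comm, smul_smul, h1, h2, h3, h4, h5, h6]
  all_goals refine congrArg ConjOp.mk ?_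
  · ring_nf
  · ring_nf
  · ring_nf
  · ring_nf
  · ring_nf
  · rw [hkk, mul_one]
  · rw [hkk, mul_one, ← hd, h6, qhat, h5]

/-- The involution as a homomorphism into the conjugate opposite algebra. -/
def starHom : A P →ₐ[ℂ] ConjOp (A P) := liftA (star_isQMat P)

/-- The involution `*` of `𝒜`. -/
def starA : A P →ₛₗ[starRingEnd ℂ] A P where
  toFun a := ConjOp.un (starHom P a)
  map_add' a b := by rw [map_add]; rfl
  map_smul' c a := by
    rw [map_smul]
    exact congrArg ConjOp.un (ConjOp.smul_mk c (ConjOp.un (starHom P a)))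

theorem starA_mul (a b : A P) : starA P (a * b) = starA P b * starA P a := by
  change ConjOp.un (starHom P (a * b)) = _
  rw [map_mul]
  rfl

theorem starA_u (i j : Fin 2) : starA P (u P i j) = starCoef P i j • u P (1 - i) (1 - j) := by
  change ConjOp.un (starHom P (u P i j)) = _
  rw [starHom, liftA_u]
  rfl

/-- A Haar functional of `𝒜`: a left- and right-invariant linear functional `h` with
`h(1) = 1`.  There is at most one such functional. -/
structure IsHaar (h : A P →ₗ[ℂ] ℂ) : Prop where
  map_one : h 1 = 1
  right_inv : ∀ a, TensorProduct.rid ℂ (A P) (TensorProduct.map LinearMap.id h (comul P a)) =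
    h a • (1 : A P)
  left_inv : ∀ a, TensorProduct.lid ℂ (A P) (TensorProduct.map h LinearMap.id (comul P a)) =
    h a • (1 : A P)

/-! ### The bicovariant `4D_±`-calculus -/

/-- The matrices `f^{ij}_{rs}(u^m_l) = ν₀ R̂^{mr}_{it} (R̂⁻¹)^{ts}_{jl}`. -/
def fmat (m l : Fin 2) : Matrix I2 I2 ℂ :=
  Matrix.of fun I K => ((P.ν₀ : ℤ) : ℂ) * ∑ t, R P m K.1 I.1 t * Rinv P t K.2 I.2 l

theorem Lp_isQMat : IsQMat P (fun m t => (Matrix.of fun i r => ((P.ν₀ : ℤ) : ℂ) * R P m r i t :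
    Matrix (Fin 2) (Fin 2) ℂ)) := by
  have hs := s_ne P
  rcases Int.units_eq_one_or P.ν₀ with hn | hn <;>
  apply isQMat_of_basic <;> ext i j <;> fin_cases i <;> fin_cases j <;>
    simp [Matrix.mul_apply, R, qhat, qc_eq, hn] <;> field_simp

theorem Lm_isQMat : IsQMat P (fun t l => (Matrix.of fun j s => Rinv P t s j l :
    Matrix (Fin 2) (Fin 2) ℂ)) := by
  have hs := s_ne P
  apply isQMat_of_basic <;> ext i j <;> fin_cases i <;> fin_cases j <;>
    simp [Matrix.mul_apply, Rinv, Cup, Cap, qhat, qc_eq] <;> field_simp <;> ring_nf <;> try simp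

open scoped Kronecker in
theorem fmat_isQMat : IsQMat P (fmat P) := by
  let F : Matrix (Fin 2) (Fin 2) ℂ →ₐ[ℂ] Matrix I2 I2 ℂ :=
    { toFun := fun M => M ⊗ₖ (1 : Matrix (Fin 2) (Fin 2) ℂ)
      map_one' := by simp
      map_mul' := fun M N => by rw [← Matrix.mul_kronecker_mul, mul_one]
      map_zero' := by simp
      map_add' := fun M N => by simp [Matrix.add_kronecker]
      commutes' := fun c => by
        simp [Algebra.algebraMap_eq_smul_one, Matrix.smul_kronecker] }
  let G : Matrix (Fin 2) (Fin 2) ℂ →ₐ[ℂ] Matrix I2 I2 ℂ :=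
    { toFun := fun M => (1 : Matrix (Fin 2) (Fin 2) ℂ) ⊗ₖ M
      map_one' := by simp
      map_mul' := fun M N => by rw [← Matrix.mul_kronecker_mul, mul_one]
      map_zero' := by simp
      map_add' := fun M N => by simp [Matrix.kronecker_add]
      commutes' := fun c => by
        simp [Algebra.algebraMap_eq_smul_one, Matrix.kronecker_smul] }
  have hFG : ∀ M N : Matrix (Fin 2) (Fin 2) ℂ, F M * G N = M ⊗ₖ N := fun M N => by
    change (M ⊗ₖ (1 : Matrix (Fin 2) (Fin 2) ℂ)) * ((1 : Matrix (Fin 2) (Fin 2) ℂ) ⊗ₖ N) = _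
    rw [← Matrix.mul_kronecker_mul, mul_one, one_mul]
  have hGF : ∀ M N : Matrix (Fin 2) (Fin 2) ℂ, G N * F M = M ⊗ₖ N := fun M N => by
    change ((1 : Matrix (Fin 2) (Fin 2) ℂ) ⊗ₖ N) * (M ⊗ₖ (1 : Matrix (Fin 2) (Fin 2) ℂ)) = _
    rw [← Matrix.mul_kronecker_mul, mul_one, one_mul]
  have h := IsQMat.mul P ((Lp_isQMat P).map P F) ((Lm_isQMat P).map P G)
    (fun i j k l => (hFG _ _).trans (hGF _ _).symm)
  convert h using 3 with m l
  ext I K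
  simp only [hFG, Matrix.sum_apply]
  simp [fmat, mul_add, mul_assoc]

/-- The matrix representation `Φ` of `𝒜` that describes the right multiplication of the basis
of left-invariant 1-forms: `θ_{ij} a = Φ(a)_{ij,rs} θ_{rs}`.  On generators
`θ_{ij} u^k_l = ν₀ R̂^{mr}_{it} (R̂⁻¹)^{ts}_{jl} u^k_m θ_{rs}`. -/
def Phi : A P →ₐ[ℂ] Matrix I2 I2 (A P) :=
  liftA (IsQMat.mul P
    ((u_isQMat P).map P (Matrix.scalarAlgHom I2 ℂ))
    ((fmat_isQMat P).map P (AlgHom.mapMatrix (Algebra.ofId ℂ (A P))))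
    (fun i j k l => by
      rw [Matrix.scalarAlgHom_apply]
      rw [Matrix.scalar_commute_iff]
      ext I K
      exact (Algebra.commutes (fmat P k l I K) (u P i j)).symm))

theorem Phi_u (k l : Fin 2) (I K : I2) :
    Phi P (u P k l) I K = ∑ m, fmat P m l I K • u P k m := by
  simp [Phi, Algebra.ofId_apply, Algebra.smul_def, Algebra.commutes]

/-- The `𝒜`-bimodule `Γ` of 1-forms, free as a left module on the left-invariant forms `θ_{ij}`;
`ρ : Gam P` stands for `∑ ρ_{ij} θ_{ij}`. -/
abbrev Gam : Type := I2 → A P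

/-- The basis element `θ_{ij}`. -/
def th (I : I2) : Gam P := Pi.single I 1

/-- The right multiplication of `Γ` by `𝒜`. -/
def rmul : Gam P →ₗ[ℂ] A P →ₗ[ℂ] Gam P :=
  LinearMap.mk₂ ℂ (fun ρ a => Matrix.vecMul ρ (Phi P a))
    (fun ρ ρ' a => Matrix.add_vecMul _ _ _)
    (fun c ρ a => Matrix.smul_vecMul _ _ _)
    (fun ρ a b => by rw [map_add, Matrix.vecMul_add])
    (fun c ρ a => by rw [map_smul, Matrix.vecMul_smul])

theorem rmul_mul (ρ : Gam P) (a b : A P) : rmul P ρ (a * b) = rmul P (rmul P ρ a) b := by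
  simp [rmul, Matrix.vecMul_vecMul]

theorem rmul_one (ρ : Gam P) : rmul P ρ 1 = ρ := by
  simp [rmul]

theorem smul_rmul (a : A P) (ρ : Gam P) (b : A P) : rmul P (a • ρ) b = a • rmul P ρ b := by
  simp [rmul, Matrix.smul_vecMul]

/-- The biinvariant form `θ = q^{1/2} q̂⁻¹ Č^{ij} θ_{ij}`. -/
def theta : Gam P := ∑ I : I2, (P.s * Cup P I.1 I.2 / qhat P) • th P I

/-- The differential `d a = θ a - a θ`. -/
def dif : A P →ₗ[ℂ] Gam P :=
  rmul P (theta P) - (LinearMap.toSpanSingleton (A P) (Gam P) (theta P)).restrictScalars ℂ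

theorem dif_apply (a : A P) : dif P a = rmul P (theta P) a - a • theta P := rfl

/-- `θ_{ij}^*`: `θ₁₁^* = κ q⁻¹ θ₂₂`, `θ₁₂^* = -θ₁₂`, `θ₂₁^* = -θ₂₁`, `θ₂₂^* = κ q θ₁₁`. -/
def starTh (I : I2) : Gam P :=
  if I = (0, 0) then (((P.κ : ℤ) : ℂ) * (qc P)⁻¹) • th P (1, 1)
  else if I = (1, 1) then (((P.κ : ℤ) : ℂ) * qc P) • th P (0, 0)
  else -th P I

/-- The involution of `Γ`, `(∑ a_{ij} θ_{ij})^* = ∑ θ_{ij}^* a_{ij}^*`. -/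
def starG : Gam P →ₛₗ[starRingEnd ℂ] Gam P where
  toFun ρ := ∑ I, rmul P (starTh P I) (starA P (ρ I))
  map_add' ρ ρ' := by simp [Finset.sum_add_distrib]
  map_smul' c ρ := by simp [Finset.smul_sum]

theorem A_induction {p : A P → Prop} (hc : ∀ c : ℂ, p (algebraMap ℂ (A P) c))
    (hu : ∀ i j, p (u P i j)) (hm : ∀ a b, p a → p b → p (a * b))
    (ha : ∀ a b, p a → p b → p (a + b)) (a : A P) : p a := by
  obtain ⟨x, rfl⟩ := RingQuot.mkAlgHom_surjective ℂ (ARel P) a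
  change p (mkA P x)
  induction x using FreeAlgebra.induction with
  | grade0 c => rw [AlgHom.commutes]; exact hc c
  | grade1 I => exact hu I.1 I.2
  | mul x y hx hy => rw [map_mul]; exact hm _ _ hx hy
  | add x y hx hy => rw [map_add]; exact ha _ _ hx hy

theorem starG_smul (a : A P) (ρ : Gam P) : starG P (a • ρ) = rmul P (starG P ρ) (starA P a) := by
  simp [starG, starA_mul, rmul_mul, map_sum]

theorem starA_one : starA P 1 = 1 := by
  change ConjOp.un (starHom P 1) = _
  rw [map_one]
  rfl

theorem starG_th (I : I2) : starG P (th P I) = starTh P I := by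
  change ∑ J, rmul P (starTh P J) (starA P (th P I J)) = _
  rw [Finset.sum_eq_single I]
  · simp [th, starA_one, rmul_one]
  · intro J _ hJ
    simp [th, hJ]
  · simp

theorem gam_eq_sum (ρ : Gam P) : ρ = ∑ I, ρ I • th P I := by
  ext J
  simp [th, Pi.single_apply]

theorem fmat_val (m l : Fin 2) (I K : I2) : fmat P m l I K = ((P.ν₀ : ℤ) : ℂ) *
    ((if m = l ∧ I = K then
        (if I.1 = m then qc P else 1) * (if I.2 = m then (qc P)⁻¹ else 1) else 0) +
      (if m = 0 ∧ l = 0 ∧ I = (0, 1) ∧ K = (1, 0) then -qhat P ^ 2 else 0) +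
      (if m = 0 ∧ l = 1 ∧ I = (0, 0) ∧ K = (1, 0) then qhat P else 0) +
      (if m = 0 ∧ l = 1 ∧ I = (0, 1) ∧ K = (1, 1) then (qc P)⁻¹ * qhat P else 0) +
      (if m = 1 ∧ l = 0 ∧ I = (0, 1) ∧ K = (0, 0) then -qhat P else 0) +
      (if m = 1 ∧ l = 0 ∧ I = (1, 1) ∧ K = (1, 0) then -(qc P * qhat P) else 0)) := by
  have hs := s_ne P
  obtain ⟨i, j⟩ := I
  obtain ⟨r, t⟩ := K
  fin_cases m <;> fin_cases l <;> fin_cases i <;> fin_cases j <;> fin_cases r <;> fin_cases t <;>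
    simp [fmat, R, Rinv, Cup, Cap, qhat, qc_eq] <;> field_simp <;>
    first | ring1 | simp

theorem fmat_conj (m l : Fin 2) (I K : I2) :
    (starRingEnd ℂ) (fmat P m l I K) = fmat P m l I K := by
  rw [fmat_val]
  simp [apply_ite (starRingEnd ℂ), conj_qc, qhat]

/-- The coefficients of `starTh`. -/
def starM (I : I2) : ℂ :=
  if I = (0, 0) then ((P.κ : ℤ) : ℂ) * (qc P)⁻¹
  else if I = (1, 1) then ((P.κ : ℤ) : ℂ) * qc P else -1

theorem starTh_eq (I : I2) : starTh P I = starM P I • th P (1 - I.2, 1 - I.1) := by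
  obtain ⟨i, j⟩ := I
  fin_cases i <;> fin_cases j <;> simp [starTh, starM]

theorem fmat_sum (m l : Fin 2) (I : I2) (F : I2 → ℂ) :
    ∑ K, fmat P m l I K * F K = ((P.ν₀ : ℤ) : ℂ) *
    ((if m = l then
        (if I.1 = m then qc P else 1) * (if I.2 = m then (qc P)⁻¹ else 1) * F I else 0) +
      (if m = 0 ∧ l = 0 ∧ I = (0, 1) then -qhat P ^ 2 * F (1, 0) else 0) +
      (if m = 0 ∧ l = 1 ∧ I = (0, 0) then qhat P * F (1, 0) else 0) +
      (if m = 0 ∧ l = 1 ∧ I = (0, 1) then (qc P)⁻¹ * qhat P * F (1, 1) else 0) +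
      (if m = 1 ∧ l = 0 ∧ I = (0, 1) then -qhat P * F (0, 0) else 0) +
      (if m = 1 ∧ l = 0 ∧ I = (1, 1) then -(qc P * qhat P) * F (1, 0) else 0)) := by
  simp only [fmat_val, mul_assoc, ← Finset.mul_sum]
  congr 1
  simp only [add_mul, Finset.sum_add_distrib, ite_mul, zero_mul]
  simp only [← and_assoc]
  simp only [ite_and, Finset.sum_ite_irrel, Finset.sum_ite_eq, Finset.sum_ite_eq',
    Finset.sum_const_zero, Finset.mem_univ, if_true]
  simp [← ite_and, mul_assoc]

set_option maxHeartbeats 1000000 in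
theorem star_scalar (I L : I2) (k l n : Fin 2) :
    ∑ K : I2, ∑ m, fmat P m l I K * starCoef P k m * starM P K *
      fmat P n (1 - m) (1 - K.2, 1 - K.1) L =
    if n = 1 - l ∧ L = (1 - I.2, 1 - I.1) then starCoef P k l * starM P I else 0 := by
  have hq := qc_ne P
  rw [Finset.sum_comm]
  simp only [mul_assoc, fmat_sum]
  obtain ⟨i, j⟩ := I
  obtain ⟨r, t⟩ := L
  fin_cases l <;> fin_cases i <;> fin_cases j <;>
    simp [starM] <;>
    fin_cases n <;> fin_cases r <;> fin_cases t <;>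
    simp [fmat_val] <;>
    rcases Int.units_eq_one_or P.ν₀ with h | h <;> rcases Int.units_eq_one_or P.κ with h' | h' <;>
    fin_cases k <;> simp [starCoef, qhat, h, h'] <;> try (field_simp <;> first | ring1 | simp)

theorem starG_rmul_u (I : I2) (k l : Fin 2) :
    starG P (rmul P (th P I) (u P k l)) = starA P (u P k l) • starTh P I := by
  have hr : ∀ (I : I2) (a : A P) (K : I2), rmul P (th P I) a K = Phi P a I K := by
    intro I a K
    simp [rmul, th]
  ext L
  change (∑ K, rmul P (starTh P K) (starA P (rmul P (th P I) (u P k l) K))) L = _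
  simp only [hr, Phi_u, map_sum, map_smulₛₗ, starA_u, fmat_conj, starTh_eq, LinearMap.smul_apply,
    Finset.sum_apply, Pi.smul_apply, RingHom.id_apply, smul_smul, smul_eq_mul, Finset.smul_sum]
  have key : ∑ n, (∑ K : I2, ∑ m, fmat P m l I K * starCoef P k m * starM P K *
      fmat P n (1 - m) (1 - K.2, 1 - K.1) L) • u P (1 - k) n = (starCoef P k l • u P (1 - k) (1 - l))
        * (starM P I • th P (1 - I.2, 1 - I.1) L) := by
    simp only [star_scalar]
    by_cases hL : L = (1 - I.2, 1 - I.1)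
    · simp [hL, th, smul_smul, mul_comm]
    · simp [hL, th]
  rw [← key]
  simp only [Finset.sum_smul]
  conv_rhs => rw [Finset.sum_comm]
  refine Finset.sum_congr rfl fun K _ => ?_
  conv_rhs => rw [Finset.sum_comm]

theorem starG_rmul_th (a : A P) :
    ∀ I, starG P (rmul P (th P I) a) = starA P a • starTh P I := by
  induction a using A_induction with
  | hc c =>
    intro I
    rw [Algebra.algebraMap_eq_smul_one, map_smul, rmul_one, map_smulₛₗ, map_smulₛₗ, starG_th,
      starA_one, smul_assoc, one_smul]
  | hu i j => exact fun I => starG_rmul_u P I i j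
  | hm a b ha hb =>
    intro I
    rw [rmul_mul, gam_eq_sum P (rmul P (th P I) a), map_sum, LinearMap.sum_apply, map_sum]
    simp only [smul_rmul, starG_smul, hb]
    rw [← Finset.smul_sum, starA_mul, mul_smul, ← ha I]
    conv_rhs => rw [gam_eq_sum P (rmul P (th P I) a), map_sum]
    simp only [starG_smul, starG_th]
  | ha a b ha hb =>
    intro I
    rw [map_add, map_add, ha, hb, map_add, add_smul]

theorem starG_rmul (ρ : Gam P) (a : A P) : starG P (rmul P ρ a) = starA P a • starG P ρ := by
  rw [gam_eq_sum P ρ, map_sum, LinearMap.sum_apply, map_sum, map_sum, Finset.smul_sum]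
  simp only [smul_rmul, starG_smul, starG_rmul_th, starG_th]

/-! ### The braiding, the `σ`-metric and the quantum Clifford algebra -/

/-- The coefficients of the braiding:
`σ (θ_{mn} ⊗ θ_{rs}) = (R̂₂₃ R̂₁₂ R̂⁻¹₃₄ R̂⁻¹₂₃)^{ijkl}_{mnrs} θ_{ij} ⊗ θ_{kl}`. -/
def sigma (I K M N : I2) : ℂ :=
  ∑ a, ∑ b, ∑ c, ∑ e, R P I.2 K.1 a b * R P I.1 a M.1 c * Rinv P b K.2 e N.2 * Rinv P c e M.2 N.1

/-- The coefficients `g(θ_{ij} ⊗ θ_{kl}) = -q^{1/2} c₁ Ĉ_{im} Ĉ_{nl} (R̂⁻¹)^{mn}_{jk}` of the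
bicovariant `σ`-metric. -/
def gco (I K : I2) : ℂ :=
  -(P.s * P.c₁) * ∑ m, ∑ n, Cap P I.1 m * Cap P n K.2 * Rinv P m n I.2 K.1

/-- The `σ`-metric `g : Γ ⊗_𝒜 Γ → 𝒜` as a balanced bilinear map; on the basis
`g(∑ a_K θ_K ⊗ ∑ b_J θ_J) = ∑ g((a_K θ_K b_J) ⊗ θ_J)`. -/
def gForm : Gam P →ₗ[ℂ] Gam P →ₗ[ℂ] A P :=
  LinearMap.mk₂ ℂ (fun ρ ρ' => ∑ J, ∑ K, gco P K J • rmul P ρ (ρ' J) K)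
    (fun ρ₁ ρ₂ ρ' => by simp [Finset.sum_add_distrib])
    (fun c ρ ρ' => by simp [Finset.smul_sum, smul_comm c])
    (fun ρ ρ₁ ρ₂ => by simp [Finset.sum_add_distrib])
    (fun c ρ ρ' => by simp [Finset.smul_sum, smul_comm c])

theorem gForm_rmul (ρ ρ' : Gam P) (a : A P) :
    gForm P (rmul P ρ a) ρ' = gForm P ρ (a • ρ') := by
  simp [gForm, rmul_mul]

/-- The defining relations of `Cl(Γ, σ, g)` on the tensor algebra of the vector space `𝒜 ⊕ Γ`:
the first four turn it into the tensor algebra of the `𝒜`-bimodule `Γ`; the last one says that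
`x = g(x)` for every `x = ∑ t_{IJ} θ_I ⊗ θ_J ∈ Γ ⊗_𝒜 Γ` with `σ(x) = x`. -/
inductive ClRel : TensorAlgebra ℂ (A P × Gam P) → TensorAlgebra ℂ (A P × Gam P) → Prop
  | one : ClRel (TensorAlgebra.ι ℂ (1, 0)) 1
  | mul (a b : A P) :
      ClRel (TensorAlgebra.ι ℂ (a, 0) * TensorAlgebra.ι ℂ (b, 0)) (TensorAlgebra.ι ℂ (a * b, 0))
  | left (a : A P) (ρ : Gam P) :
      ClRel (TensorAlgebra.ι ℂ (a, 0) * TensorAlgebra.ι ℂ (0, ρ)) (TensorAlgebra.ι ℂ (0, a • ρ))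
  | right (ρ : Gam P) (a : A P) :
      ClRel (TensorAlgebra.ι ℂ (0, ρ) * TensorAlgebra.ι ℂ (a, 0))
        (TensorAlgebra.ι ℂ (0, rmul P ρ a))
  | clifford (t : I2 → I2 → A P)
      (ht : ∀ I K, ∑ M, ∑ N, sigma P I K M N • t M N = t I K) :
      ClRel (∑ I, ∑ J, TensorAlgebra.ι ℂ (0, t I J • th P I) * TensorAlgebra.ι ℂ (0, th P J))
        (TensorAlgebra.ι ℂ (∑ I, ∑ J, gco P I J • t I J, 0))

/-- The quantum Clifford algebra `Cl(Γ, σ, g)`. -/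
def Cl : Type := RingQuot (ClRel P)

instance instRingCl : Ring (Cl P) := inferInstanceAs (Ring (RingQuot (ClRel P)))

instance instAlgebraCl : Algebra ℂ (Cl P) := inferInstanceAs (Algebra ℂ (RingQuot (ClRel P)))

/-- The canonical projection onto `Cl(Γ, σ, g)`. -/
def mkCl : TensorAlgebra ℂ (A P × Gam P) →ₐ[ℂ] Cl P := RingQuot.mkAlgHom ℂ (ClRel P)

theorem mkCl_rel {x y : TensorAlgebra ℂ (A P × Gam P)} (h : ClRel P x y) :
    mkCl P x = mkCl P y :=
  RingQuot.mkAlgHom_rel ℂ h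

/-- The canonical homomorphism `𝒜 → Cl(Γ, σ, g)`. -/
def ιA : A P →ₐ[ℂ] Cl P :=
  AlgHom.ofLinearMap
    ((mkCl P).toLinearMap ∘ₗ TensorAlgebra.ι ℂ ∘ₗ LinearMap.inl ℂ (A P) (Gam P))
    ((mkCl_rel P ClRel.one).trans (map_one _))
    (fun a b => ((mkCl_rel P (ClRel.mul a b)).symm.trans (map_mul _ _ _)))

/-- The canonical map `Γ → Cl(Γ, σ, g)`. -/
def ιΓ : Gam P →ₗ[ℂ] Cl P :=
  (mkCl P).toLinearMap ∘ₗ TensorAlgebra.ι ℂ ∘ₗ LinearMap.inr ℂ (A P) (Gam P)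

theorem ιΓ_rmul (ρ : Gam P) (a : A P) : ιΓ P (rmul P ρ a) = ιΓ P ρ * ιA P a :=
  (mkCl_rel P (ClRel.right ρ a)).symm.trans (map_mul _ _ _)

/-! ### The spinor module `S₀` -/

/-- `θ_{ij}` in the Clifford algebra. -/
def clth (i j : Fin 2) : Cl P := ιΓ P (th P (i, j))

/-- The elements `ψ^+_1, ψ^+_2` (indices `(0, 0), (0, 1)`) and `ψ^-_1, ψ^-_2`
(indices `(1, 0), (1, 1)`) of the Clifford algebra:
`ψ^+_1 = q [2]⁻¹ c₁⁻¹ θ₁₁ θ₁₂ θ₂₁ θ₂₂`, `ψ^+_2 = θ₂₁ θ₂₂`, `ψ^-_1 = θ₁₁ θ₂₁ θ₂₂`,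
`ψ^-_2 = q θ₁₂ θ₂₁ θ₂₂`. -/
def psiCl (I : I2) : Cl P :=
  if I = (0, 0) then
    (qc P / (two P * P.c₁)) • (clth P 0 0 * clth P 0 1 * clth P 1 0 * clth P 1 1)
  else if I = (0, 1) then clth P 1 0 * clth P 1 1
  else if I = (1, 0) then clth P 0 0 * clth P 1 0 * clth P 1 1
  else qc P • (clth P 0 1 * clth P 1 0 * clth P 1 1)

/-- The left ideal `S₀` of the Clifford algebra generated by the `ψ^±_i`. -/
def S₀ : Submodule (Cl P) (Cl P) := Submodule.span (Cl P) (Set.range (psiCl P))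

/-- The spinor module. -/
abbrev Sp : Type := ↥(S₀ P)

/-- `ψ^±_i` as elements of the spinor module. -/
def psi (I : I2) : Sp P := ⟨psiCl P I, Submodule.subset_span ⟨I, rfl⟩⟩

/-- The subspace of `Γ ⊗ S₀` spanned by the `ρ a ⊗ φ - ρ ⊗ a φ`. -/
def balanced : Submodule ℂ (Gam P ⊗[ℂ] Sp P) :=
  Submodule.span ℂ {x | ∃ (ρ : Gam P) (a : A P) (φ : Sp P),
    x = rmul P ρ a ⊗ₜ[ℂ] φ - ρ ⊗ₜ[ℂ] (ιA P a • φ)}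

/-- The tensor product `Γ ⊗_𝒜 S₀`. -/
abbrev GS : Type := (Gam P ⊗[ℂ] Sp P) ⧸ balanced P

/-- The element `ρ ⊗ φ` of `Γ ⊗_𝒜 S₀`. -/
def tm (ρ : Gam P) (φ : Sp P) : GS P := (balanced P).mkQ (ρ ⊗ₜ[ℂ] φ)

theorem balanced_le_ker {σ : ℂ →+* ℂ} {N : Type*} [AddCommGroup N] [Module ℂ N]
    (f : (Gam P ⊗[ℂ] Sp P) →ₛₗ[σ] N)
    (hf : ∀ ρ a φ, f (rmul P ρ a ⊗ₜ[ℂ] φ) = f (ρ ⊗ₜ[ℂ] (ιA P a • φ))) :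
    balanced P ≤ LinearMap.ker f := by
  rw [balanced, Submodule.span_le]
  rintro _ ⟨ρ, a, φ, rfl⟩
  rw [SetLike.mem_coe, LinearMap.mem_ker, map_sub, hf, sub_self]

/-- The left multiplication of `Γ ⊗_𝒜 S₀` by `a ∈ 𝒜`. -/
def lmulGS (a : A P) : GS P →ₗ[ℂ] GS P :=
  (balanced P).liftQ
    ((balanced P).mkQ ∘ₗ TensorProduct.map
      (DistribSMul.toLinearMap ℂ (Gam P) a) LinearMap.id)
    (balanced_le_ker P _ (fun ρ b φ => by
      simp only [LinearMap.comp_apply, TensorProduct.map_tmul, LinearMap.id_apply,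
        DistribSMul.toLinearMap_apply]
      rw [← sub_eq_zero, ← map_sub, ← smul_rmul]
      exact (Submodule.Quotient.mk_eq_zero _).2 (Submodule.subset_span ⟨_, _, _, rfl⟩)))

/-- The Clifford multiplication `Γ ⊗_𝒜 S₀ → S₀`, `ρ ⊗ φ ↦ ρ φ`. -/
def cliffordMul : GS P →ₗ[ℂ] Sp P :=
  (balanced P).liftQ
    (TensorProduct.lift (LinearMap.mk₂ ℂ (fun ρ φ => ιΓ P ρ • φ)
      (fun ρ ρ' φ => by rw [map_add, add_smul])
      (fun c ρ φ => by rw [map_smul, smul_assoc])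
      (fun ρ φ φ' => smul_add _ _ _)
      (fun c ρ φ => smul_comm _ _ _)))
    (balanced_le_ker P _ (fun ρ a φ => by
      simp only [TensorProduct.lift.tmul, LinearMap.mk₂_apply]
      rw [ιΓ_rmul, mul_smul]))

/-! ### Connections on `S₀` and their Dirac operators -/

/-- The map `τ` on the left-invariant elements:
`τ(ψ^+_m ⊗ θ_{jk}) = γ q^{j+k} R̂^{st}_{lk} (R̂^η)^{rl}_{mj} θ_{rs} ⊗ ψ^+_t` and
`τ(ψ^-_m ⊗ θ_{jk}) = γ q^{j+k} (R̂^η)^{st}_{lk} (R̂⁻¹)^{rl}_{mj} θ_{rs} ⊗ ψ^-_t`,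
with `j, k ∈ {1, 2}` in the exponent. -/
def tau (γ : ℂ) (η : ℤˣ) (e m : Fin 2) (J : I2) : GS P :=
  ∑ r, ∑ s, ∑ t, ∑ l,
    (γ * qc P ^ ((J.1 : ℕ) + (J.2 : ℕ) + 2) *
      (if e = 0 then R P s t l J.2 * Rpow P η r l m J.1
        else Rpow P η s t l J.2 * Rinv P r l m J.1)) • tm P (th P (r, s)) (psi P (e, t))

/-- `∇` is the left connection on `S₀` given by
`∇ψ = θ ⊗ ψ - τ(ψ ⊗ θ)`, where `τ` has the parameters `γ` and `η = η'` and `ν = 1`. -/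
structure IsSpinorConnection (γ : ℂ) (η : ℤˣ) (D : Sp P →ₗ[ℂ] GS P) : Prop where
  leibniz : ∀ (a : A P) (φ : Sp P), D (ιA P a • φ) = tm P (dif P a) φ + lmulGS P a (D φ)
  apply_psi : ∀ e m, D (psi P (e, m)) = tm P (theta P) (psi P (e, m)) -
    ∑ J : I2, (P.s * Cup P J.1 J.2 / qhat P) • tau P γ η e m J

variable {P} in
/-- The Dirac operator of the connection `D`. -/
def dirac (D : Sp P →ₗ[ℂ] GS P) : Module.End ℂ (Sp P) := cliffordMul P ∘ₗ D

/-! ### Metrics on `S₀` and the connection Laplacian -/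

/-- The antilinear algebra antiautomorphism `β` of the Clifford algebra on the left-invariant
1-forms: `β(θ₁₁) = -κ q⁻³ θ₂₂`, `β(θ₂₂) = -κ q³ θ₁₁`, `β(θ₁₂) = θ₁₂`, `β(θ₂₁) = θ₂₁`. -/
def betaTh (I : I2) : Gam P :=
  if I = (0, 0) then (-((P.κ : ℤ) : ℂ) * (qc P)⁻¹ ^ 3) • th P (1, 1)
  else if I = (1, 1) then (-((P.κ : ℤ) : ℂ) * qc P ^ 3) • th P (0, 0)
  else th P I

/-- A metric `⟨φ, ψ⟩ = h(form φ ψ)` on the spinor module: `form` is a sesquilinear left-covariant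
map with values in `𝒜` (left covariance means that it is scalar on the left-invariant spinors)
such that `⟨φ, ψ⟩` is hermitean and non-degenerate; moreover `⟨ρ φ, ψ⟩ = ⟨φ, β(ρ) ψ⟩` for the
left-invariant 1-forms `ρ`. -/
structure SpinorMetric (h : A P →ₗ[ℂ] ℂ) where
  form : Sp P →ₗ[ℂ] Sp P →ₛₗ[starRingEnd ℂ] A P
  form_smul : ∀ (a b : A P) (φ ψ : Sp P),
    form (ιA P a • φ) (ιA P b • ψ) = a * form φ ψ * starA P b
  covariant : ∀ I J, ∃ c : ℂ, form (psi P I) (psi P J) = algebraMap ℂ (A P) c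
  hermitean : ∀ φ ψ, h (form φ ψ) = (starRingEnd ℂ) (h (form ψ φ))
  nondegenerate : ∀ φ, (∀ ψ, h (form φ ψ) = 0) → φ = 0
  compatible : ∀ (I : I2) (φ ψ : Sp P),
    h (form (ιΓ P (th P I) • φ) ψ) = h (form φ (ιΓ P (betaTh P I) • ψ))

variable {P} in
theorem SpinorMetric.form_left {h : A P →ₗ[ℂ] ℂ} (M : SpinorMetric P h) (a : A P)
    (φ ψ : Sp P) : M.form (ιA P a • φ) ψ = a * M.form φ ψ := by
  simpa [starA_one] using M.form_smul a 1 φ ψ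

variable {P} in
theorem SpinorMetric.form_right {h : A P →ₗ[ℂ] ℂ} (M : SpinorMetric P h) (a : A P)
    (φ ψ : Sp P) : M.form φ (ιA P a • ψ) = M.form φ ψ * starA P a := by
  simpa using M.form_smul 1 a φ ψ

variable {P} in
/-- `ρ' ⊗ φ' ↦ g(ρ ⊗ ⟨φ, φ'⟩₀ ρ'^*)`. -/
def SpinorMetric.pairAux {h : A P →ₗ[ℂ] ℂ} (M : SpinorMetric P h) (ρ : Gam P) (φ : Sp P) :
    GS P →ₛₗ[starRingEnd ℂ] A P :=
  (balanced P).liftQ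
    (TensorProduct.lift (LinearMap.mk₂'ₛₗ (starRingEnd ℂ) (starRingEnd ℂ)
      (fun ρ' φ' => gForm P ρ (M.form φ φ' • starG P ρ'))
      (fun ρ₁ ρ₂ φ' => by rw [map_add, smul_add, map_add])
      (fun c ρ' φ' => by
        rw [(starG P).map_smulₛₗ, smul_comm, map_smul])
      (fun ρ' φ₁ φ₂ => by rw [map_add, add_smul, map_add])
      (fun c ρ' φ' => by
        rw [(M.form φ).map_smulₛₗ, smul_assoc, map_smul])))
    (balanced_le_ker P _ (fun ρ' a φ' => by
      simp only [TensorProduct.lift.tmul, LinearMap.mk₂'ₛₗ_apply]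
      rw [starG_rmul, M.form_right, mul_smul]))

variable {P} in
theorem SpinorMetric.pairAux_tm {h : A P →ₗ[ℂ] ℂ} (M : SpinorMetric P h) (ρ ρ' : Gam P)
    (φ φ' : Sp P) :
    M.pairAux ρ φ (tm P ρ' φ') = gForm P ρ (M.form φ φ' • starG P ρ') := rfl

theorem GS_ext {N : Type*} [AddCommGroup N] [Module ℂ N] {σ : ℂ →+* ℂ} {f f' : GS P →ₛₗ[σ] N}
    (hf : ∀ ρ φ, f (tm P ρ φ) = f' (tm P ρ φ)) : f = f' :=
  Submodule.linearMap_qext _ (TensorProduct.ext' hf)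

variable {P} in
/-- The sesquilinear map `g(⟨·, ·⟩₀)` on `Γ ⊗_𝒜 S₀`:
`(ρ ⊗ φ, ρ' ⊗ φ') ↦ g(ρ ⊗ ⟨φ, φ'⟩₀ ρ'^*)`. -/
def SpinorMetric.pair {h : A P →ₗ[ℂ] ℂ} (M : SpinorMetric P h) :
    GS P →ₗ[ℂ] GS P →ₛₗ[starRingEnd ℂ] A P :=
  (balanced P).liftQ
    (TensorProduct.lift (LinearMap.mk₂ ℂ (fun ρ φ => M.pairAux ρ φ)
      (fun ρ₁ ρ₂ φ => GS_ext P fun ρ' φ' => by simp [M.pairAux_tm])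
      (fun c ρ φ => GS_ext P fun ρ' φ' => by simp [M.pairAux_tm])
      (fun ρ φ₁ φ₂ => GS_ext P fun ρ' φ' => by simp [M.pairAux_tm, add_smul])
      (fun c ρ φ => GS_ext P fun ρ' φ' => by simp [M.pairAux_tm])))
    (balanced_le_ker P _ (fun ρ a φ => by
      simp only [TensorProduct.lift.tmul, LinearMap.mk₂_apply]
      refine GS_ext P fun ρ' φ' => ?_
      rw [M.pairAux_tm, M.pairAux_tm, gForm_rmul, M.form_left, mul_smul]))

variable {P} in
/-- `L` is the connection Laplacian of the connection `D`:
`⟨L ψ, ψ'⟩ = -h(g(⟨D ψ, D ψ'⟩₀))` for all spinors `ψ, ψ'`. -/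
def IsConnectionLaplacian {h : A P →ₗ[ℂ] ℂ} (M : SpinorMetric P h) (D : Sp P →ₗ[ℂ] GS P)
    (L : Module.End ℂ (Sp P)) : Prop :=
  ∀ ψ ψ' : Sp P, h (M.form (L ψ) ψ') = -h (M.pair (D ψ) (D ψ'))

/-! ### Invariant differential operators on `S₀` -/

/-- The functionals `X_I` of the quantum tangent space: `d a = a₍₁₎ X_I(a₍₂₎) θ_I`, that is,
`X_I(a)` is the value of the counit on the coefficient of `θ_I` in `d a`. -/
def tangent (I : I2) : A P →ₗ[ℂ] ℂ :=
  (counit P).toLinearMap ∘ₗ LinearMap.proj I ∘ₗ dif P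

/-- The product of functionals, `(p p')(a) = p(a₍₁₎) p'(a₍₂₎)`. -/
def conv (p p' : A P →ₗ[ℂ] ℂ) : A P →ₗ[ℂ] ℂ :=
  (TensorProduct.lid ℂ ℂ).toLinearMap ∘ₗ TensorProduct.map p p' ∘ₗ (comul P).toLinearMap

/-- The functionals of degree at most `m` in the unital algebra generated by the `X_I`. -/
def tangentFiltration : ℕ → Submodule ℂ (A P →ₗ[ℂ] ℂ)
  | 0 => Submodule.span ℂ {(counit P).toLinearMap}
  | m + 1 => tangentFiltration m ⊔
      Submodule.span ℂ {f | ∃ p ∈ tangentFiltration m, ∃ I, f = conv P p (tangent P I)}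

/-- `a ↦ a₍₁₎ p(a₍₂₎)`. -/
def leftAct (p : A P →ₗ[ℂ] ℂ) : A P →ₗ[ℂ] A P :=
  (TensorProduct.rid ℂ (A P)).toLinearMap ∘ₗ TensorProduct.map LinearMap.id p ∘ₗ
    (comul P).toLinearMap

/-- The right coaction of `𝒜 ⋊ ℂ[χ, χ⁻¹]` on `∑ b_I ψ_I`, in terms of the coefficients `b_I`:
`b ψ^±_i ↦ b₍₁₎ ψ^±_j ⊗ b₍₂₎ u^j_i χ`.  The vector space `𝒜 ⋊ ℂ[χ, χ⁻¹]` is `ℤ →₀ 𝒜`, where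
`Finsupp.single n a` stands for `a χ^n`. -/
def coaction (b : I2 → A P) : Sp P ⊗[ℂ] (ℤ →₀ A P) :=
  ∑ I : I2, ∑ j,
    TensorProduct.map
      ((LinearMap.toSpanSingleton (Cl P) (Sp P) (psi P (I.1, j))).restrictScalars ℂ ∘ₗ
        (ιA P).toLinearMap)
      (Finsupp.lsingle 1 ∘ₗ LinearMap.mulRight ℂ (u P j I.2))
      (comul P (b I))

/-- `T` is an invariant differential operator of order `m` on `S₀`: it is left-invariant,
`T(a ψ_I) = a₍₁₎ p_{JI}(a₍₂₎) ψ_J` with functionals `p_{JI}` of degree at most `m`, and it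
commutes with the right coaction of `𝒜 ⋊ ℂ[χ, χ⁻¹]`. -/
def IsInvariantDiffOp (m : ℕ) (T : Module.End ℂ (Sp P)) : Prop :=
  ∃ p : I2 → I2 → (A P →ₗ[ℂ] ℂ),
    (∀ J I, p J I ∈ tangentFiltration P m) ∧
    (∀ I a, T (ιA P a • psi P I) = ∑ J, ιA P (leftAct P (p J I) a) • psi P J) ∧
    ∀ I a, coaction P (fun J => leftAct P (p J I) a) =
      TensorProduct.map T LinearMap.id (coaction P (Pi.single I a))

end QSL

end

noncomputable section

namespace QSL

variable (P : Data)

/-! ### The relations of the Clifford algebra -/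

/-! Everything is computed on the elements a ψ_I, which span S₀ over ℂ (`Sp_span_eq_top`); their
independence is not needed. There ∇(a ψ_I) = θa ⊗ ψ_I − a τ(ψ_I ⊗ θ), and Clifford multiplication
turns τ(ψ_I ⊗ θ) into a scalar, depending only on η, γ and the chirality, times the spinor of
opposite chirality and the same index (`sum_tauCoef_mul_cliff`). So D is left multiplication by θ
minus a weighted flip of chirality. Since θ² = g(θ ⊗ θ) is a scalar, D² is a scalar plus terms
linear in the components (θa)_K.

The form h(g(⟨∇·, ∇·⟩₀)) has the same shape. Its only term quadratic in θ contains θ a b^* θ, and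
invariance of the Haar functional gives h(g(θx ⊗ θ)) = g(θ ⊗ θ) h(x), so it reduces to a multiple of
h(a b^*). In the mixed terms θ can be moved from b to a, because a ↦ Φ(a)_{IM} has an adjoint for
h(a b^*) (`IsHaar.Phi_mul_star`).

Both sides are therefore combinations of h(a b^*) and h((θa)_K b^*). Compatibility with β determines
the metric up to one factor (`SpinorMetric.coef_eq`), so equality of the coefficients is a finite
list of rational identities in q: with the factors q + 1 and q^{1/2 − 3η/2}[2] the linear parts
agree (`laplace_linear_identity`), and the scalar parts differ by the stated constant
(`laplace_scalar_identity`). Solving for the Laplacian thus gives an operator with the defining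
property; non-degeneracy makes it unique, and a scalar operator is invariant of order zero. -/

theorem two_ne : two P ≠ 0 := by
  have hq := qc_ne P
  intro h
  have h1 : qc P ^ 2 + 1 = 0 := by
    have := congrArg (· * qc P) h
    simp only [two, add_mul, zero_mul, inv_mul_cancel₀ hq] at this
    rw [sq, this]
  -- Reality of q matters: [2] vanishes at q = ±i.
  have h2 : ((P.q ^ 2 + 1 : ℝ) : ℂ) = 0 := by
    push_cast
    exact h1
  have h3 : P.q ^ 2 + 1 = 0 := by exact_mod_cast h2
  nlinarith [sq_nonneg P.q]

theorem qhat_ne : qhat P ≠ 0 := by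
  have hq := qc_ne P
  intro h
  have h1 : qc P ^ 2 - 1 = 0 := by
    have := congrArg (· * qc P) h
    simp only [qhat, sub_mul, zero_mul, inv_mul_cancel₀ hq] at this
    rw [sq, this]
  have h2 : ((P.q ^ 2 - 1 : ℝ) : ℂ) = 0 := by
    push_cast
    exact h1
  have h3 : (P.q - 1) * (P.q + 1) = 0 := by
    have : P.q ^ 2 - 1 = 0 := by exact_mod_cast h2
    linarith
  rcases mul_eq_zero.1 h3 with h4 | h4
  · exact P.q_ne_one (by linarith)
  · exact P.q_ne_neg_one (by linarith)

theorem c₁_ne : (P.c₁ : ℂ) ≠ 0 := by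
  exact_mod_cast P.c₁_ne_zero

theorem ιA_algebraMap (c : ℂ) : ιA P (algebraMap ℂ (A P) c) = algebraMap ℂ (Cl P) c :=
  AlgHom.commutes _ _

theorem clth_relation (t : I2 → I2 → ℂ)
    (ht : ∀ I K, ∑ M, ∑ N, sigma P I K M N * t M N = t I K) :
    ∑ I, ∑ J, t I J • (clth P I.1 I.2 * clth P J.1 J.2) =
      algebraMap ℂ (Cl P) (∑ I, ∑ J, gco P I J * t I J) := by
  have h := mkCl_rel P (ClRel.clifford (fun I J => algebraMap ℂ (A P) (t I J)) (fun I K => by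
    rw [← ht I K]
    simp [Algebra.smul_def, map_sum]))
  have e : ∀ a : A P, mkCl P (TensorAlgebra.ι ℂ (a, 0)) = ιA P a := fun a => rfl
  have e' : ∀ ρ : Gam P, mkCl P (TensorAlgebra.ι ℂ (0, ρ)) = ιΓ P ρ := fun a => rfl
  rw [e] at h
  simp only [map_sum, map_mul, e', algebraMap_smul, map_smul, smul_mul_assoc] at h
  simp only [clth]
  rw [h, ← ιA_algebraMap]
  simp [Algebra.smul_def]

/-- Three terms suffice for every σ-invariant tensor used below; superfluous slots get the
coefficient 0 and arbitrary indices. -/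
theorem clth_relation_three (x y z : ℂ) (X X' Y Y' Z Z' : I2)
    (ht : ∀ I K, sigma P I K X X' * x + sigma P I K Y Y' * y + sigma P I K Z Z' * z =
      (if I = X ∧ K = X' then x else 0) + (if I = Y ∧ K = Y' then y else 0) +
        (if I = Z ∧ K = Z' then z else 0)) :
    x • (clth P X.1 X.2 * clth P X'.1 X'.2) + y • (clth P Y.1 Y.2 * clth P Y'.1 Y'.2) +
      z • (clth P Z.1 Z.2 * clth P Z'.1 Z'.2) =
      algebraMap ℂ (Cl P) (gco P X X' * x + gco P Y Y' * y + gco P Z Z' * z) := by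
  have h := clth_relation P (fun I K => (if I = X ∧ K = X' then x else 0) +
    (if I = Y ∧ K = Y' then y else 0) + (if I = Z ∧ K = Z' then z else 0)) (fun I K => by
      rw [← ht I K]
      simp only [mul_add, Finset.sum_add_distrib, ite_and, mul_ite, mul_zero,
        Finset.sum_ite_irrel, Finset.sum_ite_eq', Finset.sum_const_zero, Finset.mem_univ, if_true])
  simpa only [mul_add, add_smul, Finset.sum_add_distrib, ite_and, mul_ite, mul_zero, ite_smul,
    zero_smul, Finset.sum_ite_irrel, Finset.sum_ite_eq', Finset.sum_const_zero, Finset.mem_univ,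
    if_true] using h

theorem gco_val (I K : I2) : gco P I K =
    (if I = (0, 0) ∧ K = (1, 1) then -(P.c₁ : ℂ) else 0) +
    (if I = (0, 1) ∧ K = (0, 1) then qhat P * P.c₁ else 0) +
    (if I = (0, 1) ∧ K = (1, 0) then (P.c₁ : ℂ) else 0) +
    (if I = (1, 0) ∧ K = (0, 1) then (P.c₁ : ℂ) else 0) +
    (if I = (1, 1) ∧ K = (0, 0) then -(qc P ^ 2 * P.c₁) else 0) := by
  have hs := s_ne P
  obtain ⟨i, j⟩ := I
  obtain ⟨r, t⟩ := K
  fin_cases i <;> fin_cases j <;> fin_cases r <;> fin_cases t <;>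
    simp [gco, Rinv, Cup, Cap, qhat, qc_eq] <;> field_simp <;> first | ring1 | (ring_nf; simp)

/-- With `sigma_eq` and `Rinv_val` this collapses the inner sums of the braiding, so that its
entries can be evaluated case by case. -/
theorem R_sum_right (i a m : Fin 2) (F : Fin 2 → ℂ) : ∑ c, R P i a m c * F c =
    P.s⁻¹ * ((if a = m then (if i = a then qc P else 1) * F i else 0) +
      if i = 0 ∧ m = 0 ∧ a = 1 then qhat P * F 1 else 0) := by
  fin_cases i <;> fin_cases a <;> fin_cases m <;> simp [R] <;> ring

theorem sigma_eq (I K M N : I2) : sigma P I K M N = ∑ a, ∑ b, R P I.2 K.1 a b *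
    ∑ c, R P I.1 a M.1 c * ∑ e, Rinv P b K.2 e N.2 * Rinv P c e M.2 N.1 := by
  simp only [sigma, Finset.mul_sum, mul_assoc]

theorem Rinv_val (i j k l : Fin 2) : Rinv P i j k l = P.s⁻¹ *
    if i = j then (if k = i ∧ l = i then 1 else 0)
    else if k = l then 0
    else if i = k then (if i = 0 then 0 else 1 - qc P ^ 2) else qc P := by
  have hs := s_ne P
  fin_cases i <;> fin_cases j <;> fin_cases k <;> fin_cases l <;>
    simp [Rinv, Cup, Cap, qc_eq] <;> field_simp <;> ring

-- This and the nine following lemmas each come from a σ-invariant tensor. Solved for one product,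
-- they are rewriting rules that bring words into the order θ₁₁, θ₁₂, θ₂₁, θ₂₂.
set_option maxHeartbeats 4000000 in
theorem clth_00_00 : clth P 0 0 * clth P 0 0 = 0 := by
  have hs := s_ne P
  have h := clth_relation_three P 1 0 0 (0, 0) (0, 0) (0, 0) (0, 0) (0, 0) (0, 0) (by
    rintro ⟨i, j⟩ ⟨r, t⟩
    simp only [mul_zero, add_zero, ite_self, sigma_eq, R_sum_right]
    fin_cases i <;> fin_cases j <;> fin_cases r <;> fin_cases t <;>
      simp [Rinv_val, qhat, qc_eq] <;> field_simp)
  simpa [gco_val] using h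

set_option maxHeartbeats 4000000 in
theorem clth_10_10 : clth P 1 0 * clth P 1 0 = 0 := by
  have hs := s_ne P
  have h := clth_relation_three P 1 0 0 (1, 0) (1, 0) (0, 0) (0, 0) (0, 0) (0, 0) (by
    rintro ⟨i, j⟩ ⟨r, t⟩
    simp only [mul_zero, add_zero, ite_self, sigma_eq, R_sum_right]
    fin_cases i <;> fin_cases j <;> fin_cases r <;> fin_cases t <;>
      simp [Rinv_val, qhat, qc_eq] <;> field_simp)
  simpa [gco_val] using h

set_option maxHeartbeats 4000000 in
theorem clth_11_11 : clth P 1 1 * clth P 1 1 = 0 := by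
  have hs := s_ne P
  have h := clth_relation_three P 1 0 0 (1, 1) (1, 1) (0, 0) (0, 0) (0, 0) (0, 0) (by
    rintro ⟨i, j⟩ ⟨r, t⟩
    simp only [mul_zero, add_zero, ite_self, sigma_eq, R_sum_right]
    fin_cases i <;> fin_cases j <;> fin_cases r <;> fin_cases t <;>
      simp [Rinv_val, qhat, qc_eq] <;> field_simp)
  simpa [gco_val] using h

set_option maxHeartbeats 4000000 in
theorem clth_10_00 : clth P 1 0 * clth P 0 0 = -(clth P 0 0 * clth P 1 0) := by
  have hs := s_ne P
  have h := clth_relation_three P 1 1 0 (1, 0) (0, 0) (0, 0) (1, 0) (0, 0) (0, 0) (by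
    rintro ⟨i, j⟩ ⟨r, t⟩
    simp only [mul_zero, add_zero, ite_self, sigma_eq, R_sum_right]
    fin_cases i <;> fin_cases j <;> fin_cases r <;> fin_cases t <;>
      simp [Rinv_val, qhat, qc_eq] <;> field_simp <;>
      ring1)
  simpa [gco_val, add_eq_zero_iff_eq_neg] using h

set_option maxHeartbeats 4000000 in
theorem clth_11_10 : clth P 1 1 * clth P 1 0 = -(clth P 1 0 * clth P 1 1) := by
  have hs := s_ne P
  have h := clth_relation_three P 1 1 0 (1, 1) (1, 0) (1, 0) (1, 1) (0, 0) (0, 0) (by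
    rintro ⟨i, j⟩ ⟨r, t⟩
    simp only [mul_zero, add_zero, ite_self, sigma_eq, R_sum_right]
    fin_cases i <;> fin_cases j <;> fin_cases r <;> fin_cases t <;>
      simp [Rinv_val, qhat, qc_eq] <;> field_simp <;>
      ring1)
  simpa [gco_val, add_eq_zero_iff_eq_neg] using h

set_option maxHeartbeats 4000000 in
theorem clth_01_01 : clth P 0 1 * clth P 0 1 = -(qhat P • (clth P 0 0 * clth P 1 1)) := by
  have hs := s_ne P
  have h := clth_relation_three P 1 (qhat P) 0 (0, 1) (0, 1) (0, 0) (1, 1) (0, 0) (0, 0) (by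
    rintro ⟨i, j⟩ ⟨r, t⟩
    simp only [mul_zero, add_zero, ite_self, sigma_eq, R_sum_right]
    fin_cases i <;> fin_cases j <;> fin_cases r <;> fin_cases t <;>
      simp [Rinv_val, qhat, qc_eq] <;> field_simp <;>
      ring1)
  simp [gco_val, mul_comm] at h
  exact add_eq_zero_iff_eq_neg.1 h

set_option maxHeartbeats 4000000 in
theorem clth_11_00 : clth P 1 1 * clth P 0 0 = -(clth P 0 0 * clth P 1 1) +
    algebraMap ℂ (Cl P) (-(qc P * two P * P.c₁)) := by
  have hs := s_ne P
  have h := clth_relation_three P 1 1 0 (1, 1) (0, 0) (0, 0) (1, 1) (0, 0) (0, 0) (by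
    rintro ⟨i, j⟩ ⟨r, t⟩
    simp only [mul_zero, add_zero, ite_self, sigma_eq, R_sum_right]
    fin_cases i <;> fin_cases j <;> fin_cases r <;> fin_cases t <;>
      simp [Rinv_val, qhat, qc_eq] <;> field_simp <;>
      ring1)
  -- The value is −q²c₁ − c₁ = −q[2]c₁.
  have e : gco P (1, 1) (0, 0) * 1 + gco P (0, 0) (1, 1) * 1 + gco P (0, 0) (0, 0) * 0 =
      -(qc P * two P * P.c₁) := by
    have hq := qc_ne P
    simp [gco_val, two]
    field_simp
    ring
  rw [e] at h
  rw [← h]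
  simp

set_option maxHeartbeats 4000000 in
theorem clth_01_00 : clth P 0 1 * clth P 0 0 = -(qc P ^ 2 • (clth P 0 0 * clth P 0 1)) -
    qhat P • (clth P 0 0 * clth P 1 0) := by
  have hs := s_ne P
  have h := clth_relation_three P 1 (qc P ^ 2) (qhat P) (0, 1) (0, 0) (0, 0) (0, 1) (0, 0) (1, 0) (by
    rintro ⟨i, j⟩ ⟨r, t⟩
    simp only [sigma_eq, R_sum_right]
    fin_cases i <;> fin_cases j <;> fin_cases r <;> fin_cases t <;>
      simp [Rinv_val, qhat, qc_eq] <;> field_simp <;>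
      ring1)
  simp [gco_val] at h
  linear_combination (norm := module) h

set_option maxHeartbeats 4000000 in
theorem clth_11_01 : clth P 1 1 * clth P 0 1 = -(qc P ^ 2 • (clth P 0 1 * clth P 1 1)) -
    qhat P • (clth P 1 0 * clth P 1 1) := by
  have hs := s_ne P
  have h := clth_relation_three P 1 (qc P ^ 2) (qhat P) (1, 1) (0, 1) (0, 1) (1, 1) (1, 0) (1, 1) (by
    rintro ⟨i, j⟩ ⟨r, t⟩
    simp only [sigma_eq, R_sum_right]
    fin_cases i <;> fin_cases j <;> fin_cases r <;> fin_cases t <;>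
      simp [Rinv_val, qhat, qc_eq] <;> field_simp <;>
      ring1)
  simp [gco_val] at h
  linear_combination (norm := module) h

set_option maxHeartbeats 4000000 in
theorem clth_10_01 : clth P 1 0 * clth P 0 1 = -(clth P 0 1 * clth P 1 0) -
    ((qc P)⁻¹ * qhat P) • (clth P 0 0 * clth P 1 1) +
    algebraMap ℂ (Cl P) ((qc P)⁻¹ * two P * P.c₁) := by
  have hs := s_ne P
  have h := clth_relation_three P 1 1 ((qc P)⁻¹ * qhat P) (1, 0) (0, 1) (0, 1) (1, 0) (0, 0) (1, 1)
    (by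
    rintro ⟨i, j⟩ ⟨r, t⟩
    simp only [sigma_eq, R_sum_right]
    fin_cases i <;> fin_cases j <;> fin_cases r <;> fin_cases t <;>
      simp [Rinv_val, qhat, qc_eq] <;> field_simp <;>
      ring1)
  -- The value is 2c₁ − (1 − q⁻²)c₁ = q⁻¹[2]c₁.
  have e : gco P (1, 0) (0, 1) * 1 + gco P (0, 1) (1, 0) * 1 +
      gco P (0, 0) (1, 1) * ((qc P)⁻¹ * qhat P) = (qc P)⁻¹ * two P * P.c₁ := by
    have hq := qc_ne P
    simp [gco_val, two, qhat]
    field_simp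
    ring
  rw [e] at h
  rw [← h]
  module

/-! ### The action of the 1-forms on the spinors -/

/-- The matrix coefficients of the Clifford multiplication: `θ_K ψ_I = ∑ cliff K I J ψ_J`. -/
def cliff (K I J : I2) : ℂ :=
  (if K = (0, 0) ∧ I = (0, 1) ∧ J = (1, 0) then 1 else 0) +
  (if K = (0, 1) ∧ I = (0, 1) ∧ J = (1, 1) then (qc P)⁻¹ else 0) +
  (if K = (0, 1) ∧ I = (0, 0) ∧ J = (1, 0) then -qhat P else 0) +
  (if K = (1, 0) ∧ I = (0, 0) ∧ J = (1, 0) then -1 else 0) +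
  (if K = (1, 1) ∧ I = (0, 0) ∧ J = (1, 1) then -qc P else 0) +
  (if K = (0, 1) ∧ I = (1, 0) ∧ J = (0, 0) then -(qc P * two P * P.c₁) else 0) +
  (if K = (1, 1) ∧ I = (1, 0) ∧ J = (0, 1) then -(qc P * two P * P.c₁) else 0) +
  (if K = (0, 0) ∧ I = (1, 1) ∧ J = (0, 0) then two P * P.c₁ else 0) +
  (if K = (1, 0) ∧ I = (1, 1) ∧ J = (0, 1) then two P * P.c₁ else 0)

/-- The word `x * y` may be replaced in front of another factor. -/
theorem mul_mul_of_eq {B : Type*} [Ring B] {x y w : B} (h : x * y = w) (z : B) :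
    x * (y * z) = w * z := by
  rw [← mul_assoc, h]

-- θ₂₁θ₂₂ is annihilated by θ₂₁ and θ₂₂ and plays the role of a vacuum: up to scalars the ψ_I are 1,
-- θ₁₁, θ₁₂ and θ₁₁θ₁₂ applied to it. Hence reordering θ_K ψ_I leads back to the ψ_J.
set_option maxHeartbeats 1000000 in
theorem clth_mul_psiCl (K I : I2) :
    clth P K.1 K.2 * psiCl P I = ∑ J, cliff P K I J • psiCl P J := by
  have hq := qc_ne P
  have h2 := two_ne P
  have hc := c₁_ne P
  obtain ⟨i, j⟩ := K
  obtain ⟨e, m⟩ := I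
  fin_cases i <;> fin_cases j <;> fin_cases e <;> fin_cases m <;>
    simp [psiCl, cliff, Fintype.sum_prod_type] <;>
    simp only [mul_assoc, clth_11_11, mul_mul_of_eq (clth_00_00 P),
      mul_mul_of_eq (clth_10_10 P), mul_mul_of_eq (clth_10_00 P), mul_mul_of_eq (clth_11_10 P),
      mul_mul_of_eq (clth_01_01 P), mul_mul_of_eq (clth_11_00 P), mul_mul_of_eq (clth_01_00 P),
      mul_mul_of_eq (clth_11_01 P), mul_mul_of_eq (clth_10_01 P), mul_add, mul_sub, add_mul,
      sub_mul, neg_mul, smul_mul_assoc, mul_smul_comm, mul_zero, zero_mul, smul_zero, neg_zero,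
      Algebra.algebraMap_eq_smul_one, one_mul] <;>
    first
    | simp; done
    | (match_scalars; field_simp)

theorem th_smul_psi (K I : I2) :
    ιΓ P (th P K) • psi P I = ∑ J, cliff P K I J • psi P J := by
  apply Subtype.ext
  rw [AddSubmonoidClass.coe_finsetSum]
  exact clth_mul_psiCl P K I

theorem ιΓ_smul (a : A P) (ρ : Gam P) : ιΓ P (a • ρ) = ιA P a * ιΓ P ρ :=
  (mkCl_rel P (ClRel.left a ρ)).symm.trans (map_mul _ _ _)

theorem ιΓ_eq_sum (ρ : Gam P) : ιΓ P ρ = ∑ K, ιA P (ρ K) * ιΓ P (th P K) := by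
  conv_lhs => rw [gam_eq_sum P ρ, map_sum]
  simp only [ιΓ_smul]

theorem ιΓ_smul_ιA_smul_psi (ρ : Gam P) (a : A P) (I : I2) :
    ιΓ P ρ • (ιA P a • psi P I) =
      ∑ K, ∑ J, cliff P K I J • (ιA P (rmul P ρ a K) • psi P J) := by
  rw [← mul_smul, ← ιΓ_rmul, ιΓ_eq_sum, Finset.sum_smul]
  refine Finset.sum_congr rfl fun K _ => ?_
  rw [mul_smul, th_smul_psi, Finset.smul_sum]
  refine Finset.sum_congr rfl fun J _ => ?_
  rw [smul_comm]

/-- The spinor module is spanned by the `a ψ_I`. -/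
theorem Sp_span_eq_top :
    Submodule.span ℂ (Set.range fun x : A P × I2 => ιA P x.1 • psi P x.2) = ⊤ := by
  -- The span contains the ψ_I and is stable under 𝒜 and Γ, which generate the Clifford algebra; for
  -- Γ this is the closure of the ψ_I under the θ_K.
  set W := Submodule.span ℂ (Set.range fun x : A P × I2 => ιA P x.1 • psi P x.2) with hW
  have hmem : ∀ a I, ιA P a • psi P I ∈ W := fun a I => Submodule.subset_span ⟨(a, I), rfl⟩
  have hA : ∀ (a : A P), ∀ φ ∈ W, ιA P a • φ ∈ W := by
    intro a φ hφ
    induction hφ using Submodule.span_induction with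
    | mem x hx =>
      obtain ⟨⟨b, I⟩, rfl⟩ := hx
      rw [← mul_smul, ← map_mul]
      exact hmem _ _
    | zero => rw [smul_zero]; exact W.zero_mem
    | add x y _ _ hx hy => rw [smul_add]; exact W.add_mem hx hy
    | smul c x _ hx => rw [smul_comm]; exact W.smul_mem c hx
  have hΓ : ∀ (ρ : Gam P), ∀ φ ∈ W, ιΓ P ρ • φ ∈ W := by
    intro ρ φ hφ
    induction hφ using Submodule.span_induction with
    | mem x hx =>
      obtain ⟨⟨b, I⟩, rfl⟩ := hx
      simp only [ιΓ_smul_ιA_smul_psi]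
      exact W.sum_mem fun K _ => W.sum_mem fun J _ => W.smul_mem _ (hmem _ _)
    | zero => rw [smul_zero]; exact W.zero_mem
    | add x y _ _ hx hy => rw [smul_add]; exact W.add_mem hx hy
    | smul c x _ hx => rw [smul_comm]; exact W.smul_mem c hx
  have hCl : ∀ (x : Cl P), ∀ φ ∈ W, x • φ ∈ W := by
    intro x
    obtain ⟨y, rfl⟩ := RingQuot.mkAlgHom_surjective ℂ (ClRel P) x
    change ∀ φ ∈ W, mkCl P y • φ ∈ W
    induction y using TensorAlgebra.induction with
    | algebraMap c =>
      intro φ hφ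
      rw [AlgHom.commutes, algebraMap_smul]
      exact W.smul_mem c hφ
    | ι x =>
      intro φ hφ
      have e : mkCl P (TensorAlgebra.ι ℂ x) = ιA P x.1 + ιΓ P x.2 := by
        have : x = (x.1, 0) + (0, x.2) := by simp
        conv_lhs => rw [this, map_add, map_add]
        rfl
      rw [e, add_smul]
      exact W.add_mem (hA _ _ hφ) (hΓ _ _ hφ)
    | mul x y hx hy =>
      intro φ hφ
      rw [map_mul, mul_smul]
      exact hx _ (hy _ hφ)
    | add x y hx hy =>
      intro φ hφ
      rw [map_add, add_smul]
      exact W.add_mem (hx _ hφ) (hy _ hφ)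
  rw [eq_top_iff]
  rintro ⟨φ, hφ⟩ -
  induction hφ using Submodule.span_induction with
  | mem x hx =>
    obtain ⟨I, rfl⟩ := hx
    have h := hmem 1 I
    rwa [map_one, one_smul] at h
  | zero => exact W.zero_mem
  | add x y _ _ hx hy => exact W.add_mem hx hy
  | smul c x _ hx => exact hCl c _ hx

variable {P} in
theorem Sp_hom_ext {σ : ℂ →+* ℂ} {N : Type*} [AddCommGroup N] [Module ℂ N]
    {f f' : Sp P →ₛₗ[σ] N} (h : ∀ a I, f (ιA P a • psi P I) = f' (ιA P a • psi P I)) :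
    f = f' :=
  LinearMap.ext_on_range (Sp_span_eq_top P) fun x => h x.1 x.2

/-! ### The Haar functional and the commutation rules of the calculus -/

theorem counit_u (i j : Fin 2) : counit P (u P i j) = if i = j then 1 else 0 := by
  simp [counit]

/-- The functionals `f_{IK}` with `θ_I a = a₍₁₎ f_{IK}(a₍₂₎) θ_K`. -/
def PhiCounit (I K : I2) : A P →ₗ[ℂ] ℂ :=
  (counit P).toLinearMap ∘ₗ
    { toFun := fun a => Phi P a I K
      map_add' := fun a b => by simp
      map_smul' := fun c a => by simp }

theorem PhiCounit_apply (I K : I2) (a : A P) : PhiCounit P I K a = counit P (Phi P a I K) := rfl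

theorem PhiCounit_one (I K : I2) : PhiCounit P I K 1 = if I = K then 1 else 0 := by
  rw [PhiCounit_apply, map_one, Matrix.one_apply]
  split_ifs <;> simp

theorem PhiCounit_mul (I K : I2) (a b : A P) :
    PhiCounit P I K (a * b) = ∑ L, PhiCounit P I L a * PhiCounit P L K b := by
  simp [PhiCounit_apply, Matrix.mul_apply]

/-- This expresses the left-invariance of the θ_I. Both sides are multiplicative as matrices in I,
K, so the generators decide. -/
theorem Phi_eq_leftAct (a : A P) : ∀ I K, Phi P a I K = leftAct P (PhiCounit P I K) a := by
  induction a using A_induction with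
  | hc c =>
    intro I K
    simp only [leftAct, LinearMap.comp_apply, AlgHom.toLinearMap_apply, AlgHom.commutes,
      Algebra.TensorProduct.algebraMap_apply, TensorProduct.map_tmul, LinearMap.id_apply,
      LinearEquiv.coe_coe, TensorProduct.rid_tmul, PhiCounit_one, Matrix.algebraMap_matrix_apply]
    split_ifs <;> simp
  | hu i j =>
    intro I K
    simp only [leftAct, LinearMap.comp_apply, AlgHom.toLinearMap_apply, comul_u, map_sum,
      TensorProduct.map_tmul, LinearMap.id_apply, LinearEquiv.coe_coe, TensorProduct.rid_tmul,
      PhiCounit_apply, Phi_u, map_smul, counit_u]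
    refine Finset.sum_congr rfl fun k _ => ?_
    congr 1
    simp
  | hm a b ha hb =>
    intro I K
    rw [map_mul, Matrix.mul_apply]
    simp only [ha, hb, leftAct, LinearMap.comp_apply, AlgHom.toLinearMap_apply, map_mul]
    generalize comul P a = x
    generalize comul P b = y
    induction x using TensorProduct.induction_on with
    | zero => simp
    | add x x' hx hx' => simp only [add_mul, map_add, hx, hx', Finset.sum_add_distrib]
    | tmul x x' =>
      induction y using TensorProduct.induction_on with
      | zero => simp
      | add y y' hy hy' => simp only [mul_add, map_add, hy, hy', Finset.sum_add_distrib]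
      | tmul y y' =>
        simp [Algebra.TensorProduct.tmul_mul_tmul, PhiCounit_mul, Finset.sum_smul, smul_smul,
          mul_comm]
  | ha a b ha hb =>
    intro I K
    simp [ha, hb]

-- Apply the functional f_{IK} to h(a₍₁₎) a₍₂₎ = h(a) 1 and use f_{IK}(1) = δ_{IK}.
variable {P} in
theorem IsHaar.Phi {h : A P →ₗ[ℂ] ℂ} (hh : IsHaar P h) (a : A P) (I K : I2) :
    h (Phi P a I K) = if I = K then h a else 0 := by
  have e : h ∘ₗ (TensorProduct.rid ℂ (A P)).toLinearMap ∘ₗ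
        TensorProduct.map LinearMap.id (PhiCounit P I K) =
      PhiCounit P I K ∘ₗ (TensorProduct.lid ℂ (A P)).toLinearMap ∘ₗ
        TensorProduct.map h LinearMap.id :=
    TensorProduct.ext' fun x y => by simp [mul_comm]
  have e' := LinearMap.congr_fun e (comul P a)
  simp only [LinearMap.comp_apply, LinearEquiv.coe_coe] at e'
  rw [hh.left_inv, map_smul, PhiCounit_one] at e'
  rw [Phi_eq_leftAct]
  simp only [leftAct, LinearMap.comp_apply, AlgHom.toLinearMap_apply, LinearEquiv.coe_coe]
  rw [e']
  split_ifs <;> simp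

/-- The involution `ij ↦ (3-j)(3-i)` of the pairs of indices. -/
def bar (I : I2) : I2 := (1 - I.2, 1 - I.1)

/-- The coefficients of `betaTh`. -/
def betaM (I : I2) : ℂ :=
  if I = (0, 0) then -((P.κ : ℤ) : ℂ) * (qc P)⁻¹ ^ 3
  else if I = (1, 1) then -((P.κ : ℤ) : ℂ) * qc P ^ 3 else 1

theorem betaTh_eq (I : I2) : betaTh P I = betaM P I • th P (bar I) := by
  obtain ⟨i, j⟩ := I
  fin_cases i <;> fin_cases j <;> simp [betaTh, betaM, bar]

theorem kappa_ne : ((P.κ : ℤ) : ℂ) ≠ 0 := fun h => by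
  have := kappa_sq P
  simp [h] at this

theorem conj_betaM (I : I2) : (starRingEnd ℂ) (betaM P I) = betaM P I := by
  unfold betaM
  split_ifs <;> simp [conj_qc]

theorem conj_qhat : (starRingEnd ℂ) (qhat P) = qhat P := by
  simp [qhat, conj_qc]

theorem conj_two : (starRingEnd ℂ) (two P) = two P := by
  simp [two, conj_qc]

theorem conj_cliff (K I J : I2) : (starRingEnd ℂ) (cliff P K I J) = cliff P K I J := by
  simp [cliff, apply_ite (starRingEnd ℂ), conj_qc, conj_qhat, conj_two]

-- The generator case of `sum_Phi_starA`, reduced to scalars.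
set_option maxHeartbeats 1000000 in
theorem beta_scalar (M N : I2) (k l n : Fin 2) :
    ∑ m, ∑ K : I2, fmat P n (1 - m) M K * (fmat P m l (bar K) (bar N) * starCoef P k m *
      betaM P K) = if n = 1 - l ∧ M = N then starCoef P k l * betaM P N else 0 := by
  have hq := qc_ne P
  simp only [fmat_sum]
  obtain ⟨i, j⟩ := M
  obtain ⟨r, t⟩ := N
  fin_cases l <;> fin_cases i <;> fin_cases j <;>
    simp [betaM, bar] <;>
    fin_cases n <;> fin_cases r <;> fin_cases t <;>
    simp [fmat_val] <;>
    rcases Int.units_eq_one_or P.ν₀ with h | h <;> rcases Int.units_eq_one_or P.κ with h' | h' <;>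
    fin_cases k <;> simp [starCoef, qhat, h, h'] <;> try (field_simp <;> ring1)

-- The generator case of `gForm_right`, reduced to scalars: g is invariant under the commutation
-- matrices of the calculus.
set_option maxHeartbeats 1000000 in
theorem gco_scalar (I J : I2) (l n : Fin 2) :
    ∑ m, ∑ K : I2, fmat P n m I K * ∑ L : I2, fmat P m l J L * gco P K L =
      if n = l then gco P I J else 0 := by
  have hq := qc_ne P
  simp only [fmat_sum]
  obtain ⟨i, j⟩ := I
  obtain ⟨r, t⟩ := J
  fin_cases l <;> fin_cases n <;> fin_cases i <;> fin_cases j <;>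
    simp <;>
    fin_cases r <;> fin_cases t <;>
    simp [gco_val] <;>
    rcases Int.units_eq_one_or P.ν₀ with h | h <;>
    simp [qhat, h] <;> try (field_simp <;> ring1)

theorem bar_bar (I : I2) : bar (bar I) = I := by
  simp [bar]

/-- Up to the weights β, the matrix Φ undoes its own conjugate under the involution. This is what
turns the invariance `IsHaar.Phi` into an adjunction. -/
theorem sum_Phi_starA (b : A P) : ∀ M N : I2,
    ∑ K, betaM P K • Phi P (starA P (Phi P b (bar K) (bar N))) M K =
      if M = N then betaM P N • starA P b else 0 := by
  induction b using A_induction with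
  | hc c =>
    intro M N
    have hb : ∀ K, (bar K = bar N) ↔ K = N := fun K =>
      ⟨fun h => by rw [← bar_bar K, h, bar_bar], fun h => by rw [h]⟩
    rw [Finset.sum_eq_single N]
    · simp only [if_true, Algebra.algebraMap_eq_smul_one,
        map_smulₛₗ, starA_one, RingHom.id_apply, map_one, Matrix.smul_apply, Matrix.one_apply]
      split_ifs <;> simp
    · intro K _ hK
      simp [Matrix.algebraMap_matrix_apply, hb, hK]
    · simp
  | hu k l =>
    intro M N
    have key : ∑ n, (∑ m, ∑ K : I2, fmat P n (1 - m) M K *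
        (fmat P m l (bar K) (bar N) * starCoef P k m * betaM P K)) • u P (1 - k) n =
        if M = N then betaM P N • starA P (u P k l) else 0 := by
      simp only [beta_scalar, starA_u]
      by_cases h : M = N
      · simp [h, smul_smul, mul_comm]
      · simp [h]
    rw [← key]
    simp only [Phi_u, map_sum, map_smulₛₗ, starA_u, fmat_conj, smul_smul, RingHom.id_apply,
      Matrix.sum_apply, Matrix.smul_apply, Finset.smul_sum, Finset.sum_smul]
    rw [Finset.sum_comm]
    conv_rhs => rw [Finset.sum_comm]
    refine Finset.sum_congr rfl fun m _ => ?_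
    rw [Finset.sum_comm]
    refine Finset.sum_congr rfl fun n _ => Finset.sum_congr rfl fun K _ => ?_
    congr 1
    ring
  | hm a b ha hb =>
    intro M N
    have e : ∀ K, betaM P K • Phi P (starA P (Phi P (a * b) (bar K) (bar N))) M K =
        ∑ L, ∑ J, Phi P (starA P (Phi P b (bar L) (bar N))) M J *
          betaM P K • Phi P (starA P (Phi P a (bar K) (bar L))) J K := by
      intro K
      have hs : ∑ L, Phi P a (bar K) L * Phi P b L (bar N) =
          ∑ L, Phi P a (bar K) (bar L) * Phi P b (bar L) (bar N) :=
        (Fintype.sum_equiv ⟨bar, bar, bar_bar, bar_bar⟩ _ _ fun L => rfl).symm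
      simp only [map_mul, Matrix.mul_apply, hs, map_sum, starA_mul, Matrix.sum_apply,
        Finset.smul_sum, mul_smul_comm]
    simp only [e]
    rw [Finset.sum_comm]
    -- The hypothesis for a collapses the sum over K to J = L and leaves exactly the sum for b.
    have e' : ∀ L, ∑ K, ∑ J, Phi P (starA P (Phi P b (bar L) (bar N))) M J *
          betaM P K • Phi P (starA P (Phi P a (bar K) (bar L))) J K =
        betaM P L • Phi P (starA P (Phi P b (bar L) (bar N))) M L * starA P a := by
      intro L
      rw [Finset.sum_comm]
      simp only [← Finset.mul_sum, ha, mul_ite, mul_zero, Finset.sum_ite_eq', Finset.mem_univ,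
        if_true]
      rw [mul_smul_comm, smul_mul_assoc]
    simp only [e', ← Finset.sum_mul, hb, starA_mul]
    split_ifs <;> simp
  | ha a b ha hb =>
    intro M N
    simp only [map_add, Matrix.add_apply, smul_add, Finset.sum_add_distrib, ha, hb]
    split_ifs <;> simp

variable {P} in
/-- The adjoint of `a ↦ Φ(a)_{IM}` with respect to the sesquilinear form `h(a b^*)`. -/
theorem IsHaar.Phi_mul_star {h : A P →ₗ[ℂ] ℂ} (hh : IsHaar P h) (a b : A P) (I M : I2) :
    betaM P M * h (QSL.Phi P a I M * starA P b) =
      betaM P I * h (a * starA P (QSL.Phi P b (bar I) (bar M))) := by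
  -- The Kronecker delta is traded for Φ by `IsHaar.Phi` at the product a Φ(b)^*; expanding Φ of
  -- this product and summing over K with the weights β_K makes `sum_Phi_starA` applicable.
  have e : ∀ K, betaM P K • (if I = K then h (a * starA P (QSL.Phi P b (bar K) (bar M))) else 0) =
      ∑ L, h (QSL.Phi P a I L *
        (betaM P K • QSL.Phi P (starA P (QSL.Phi P b (bar K) (bar M))) L K)) := by
    intro K
    rw [← hh.Phi, map_mul, Matrix.mul_apply, map_sum, Finset.smul_sum]
    simp only [mul_smul_comm, map_smul]
  have e' := Finset.sum_congr rfl fun K (_ : K ∈ (Finset.univ : Finset I2)) => e K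
  rw [Finset.sum_comm] at e'
  simp only [← map_sum, ← Finset.mul_sum, sum_Phi_starA] at e'
  simp only [smul_eq_mul, mul_ite, mul_zero, Finset.sum_ite_eq, Finset.sum_ite_eq',
    Finset.mem_univ, if_true, mul_smul_comm, map_smul] at e'
  exact e'.symm

/-! ### The `σ`-metric is a bimodule map -/

theorem gForm_smul_left (a : A P) (ρ ρ' : Gam P) : gForm P (a • ρ) ρ' = a * gForm P ρ ρ' := by
  simp [gForm, smul_rmul, Finset.mul_sum]

theorem rmul_th (I : I2) (a : A P) (K : I2) : rmul P (th P I) a K = Phi P a I K := by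
  simp [rmul, th]

theorem gForm_th (I J : I2) : gForm P (th P I) (th P J) = algebraMap ℂ (A P) (gco P I J) := by
  simp only [gForm, LinearMap.mk₂_apply, rmul_th]
  rw [Finset.sum_eq_single J, Finset.sum_eq_single I]
  · simp [th, Algebra.algebraMap_eq_smul_one]
  · intro K _ hK
    simp [th, hK.symm]
  · simp
  · intro K _ hK
    simp [th, hK]
  · simp

theorem gForm_th_rmul_th_u (I J : I2) (k l : Fin 2) :
    gForm P (th P I) (rmul P (th P J) (u P k l)) = gForm P (th P I) (th P J) * u P k l := by
  have key : ∑ n, (∑ m, ∑ K : I2, fmat P n m I K * ∑ L : I2, fmat P m l J L * gco P K L) •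
      u P k n = algebraMap ℂ (A P) (gco P I J) * u P k l := by
    simp only [gco_scalar]
    simp only [ite_smul, zero_smul, Finset.sum_ite_eq', Finset.mem_univ, if_true]
    exact Algebra.smul_def _ _
  rw [gForm_th, ← key]
  simp only [gForm, LinearMap.mk₂_apply, rmul_th, Phi_u, map_sum, map_smul, Matrix.sum_apply,
    Matrix.smul_apply, Finset.smul_sum, Finset.sum_smul, Finset.mul_sum, smul_smul]
  rw [Finset.sum_comm]
  have e : ∀ F : I2 → I2 → Fin 2 → Fin 2 → A P, ∑ K, ∑ L, ∑ m, ∑ n, F K L m n =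
      ∑ n, ∑ m, ∑ K, ∑ L, F K L m n := by
    intro F
    calc _ = ∑ K, ∑ m, ∑ L, ∑ n, F K L m n :=
          Finset.sum_congr rfl fun K _ => Finset.sum_comm
      _ = ∑ m, ∑ K, ∑ L, ∑ n, F K L m n := Finset.sum_comm
      _ = ∑ m, ∑ K, ∑ n, ∑ L, F K L m n :=
          Finset.sum_congr rfl fun m _ => Finset.sum_congr rfl fun K _ => Finset.sum_comm
      _ = ∑ m, ∑ n, ∑ K, ∑ L, F K L m n :=
          Finset.sum_congr rfl fun m _ => Finset.sum_comm
      _ = _ := Finset.sum_comm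
  rw [e]
  refine Finset.sum_congr rfl fun n _ => Finset.sum_congr rfl fun m _ =>
    Finset.sum_congr rfl fun K _ => Finset.sum_congr rfl fun L _ => ?_
  congr 1
  ring

/-- Balancedness and left linearity are immediate from the form of `gForm`; right linearity depends
on its coefficients. It allows b^* to be pulled out of the pairing on Γ ⊗ S₀. -/
theorem gForm_right (a : A P) :
    ∀ ρ ρ' : Gam P, gForm P ρ (rmul P ρ' a) = gForm P ρ ρ' * a := by
  induction a using A_induction with
  | hc c =>
    intro ρ ρ'
    rw [Algebra.algebraMap_eq_smul_one, map_smul, rmul_one, map_smul, mul_smul_comm, mul_one]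
  | hu k l =>
    have h1 : ∀ (J : I2) (ρ : Gam P), gForm P ρ (rmul P (th P J) (u P k l)) =
        gForm P ρ (th P J) * u P k l := by
      intro J ρ
      rw [gam_eq_sum P ρ]
      simp only [map_sum, LinearMap.sum_apply, Finset.sum_mul, gForm_smul_left, mul_assoc,
        gForm_th_rmul_th_u]
    intro ρ ρ'
    rw [gam_eq_sum P ρ']
    simp only [map_sum, LinearMap.sum_apply, Finset.sum_mul, smul_rmul, ← gForm_rmul, h1]
  | hm a b ha hb =>
    intro ρ ρ'
    rw [rmul_mul, hb, ha, mul_assoc]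
  | ha a b ha hb =>
    intro ρ ρ'
    rw [map_add, map_add, ha, hb, mul_add]

/-! ### The coefficients of the metric on the spinors -/

/-- `g(θ_K ⊗ θ_M^*)`. -/
def gStar (K M : I2) : ℂ := starM P M * gco P K (bar M)

theorem gForm_th_starTh (K M : I2) :
    gForm P (th P K) (starTh P M) = algebraMap ℂ (A P) (gStar P K M) := by
  rw [starTh_eq, map_smul]
  change starM P M • gForm P (th P K) (th P (bar M)) = _
  rw [gForm_th, Algebra.algebraMap_eq_smul_one, Algebra.algebraMap_eq_smul_one, smul_smul, gStar]

theorem lmulGS_tm (a : A P) (ρ : Gam P) (φ : Sp P) : lmulGS P a (tm P ρ φ) = tm P (a • ρ) φ := rfl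

theorem tm_sum_smul (ρ : Gam P) (φ : Sp P) :
    tm P ρ φ = ∑ K, lmulGS P (ρ K) (tm P (th P K) φ) := by
  conv_lhs => rw [gam_eq_sum P ρ]
  simp only [tm, TensorProduct.sum_tmul, map_sum]
  rfl

/-- The spinor index of the opposite chirality. -/
def opp (I : I2) : I2 := (1 - I.1, I.2)

/-- The ratios of the non-zero coefficients of a metric on the spinors. -/
def metricRatio (m : Fin 2) : ℂ := if m = 0 then ((P.κ : ℤ) : ℂ) * (qc P)⁻¹ ^ 2 else 1

namespace SpinorMetric

variable {P} {h : A P →ₗ[ℂ] ℂ} (M : SpinorMetric P h)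

theorem pair_tm (ρ ρ' : Gam P) (φ φ' : Sp P) :
    M.pair (tm P ρ φ) (tm P ρ' φ') = gForm P ρ (M.form φ φ' • starG P ρ') := rfl

/-- `⟨ψ_I, ψ_J⟩`. -/
def coef (I J : I2) : ℂ := h (M.form (psi P I) (psi P J))

theorem form_psi (hh : IsHaar P h) (I J : I2) :
    M.form (psi P I) (psi P J) = algebraMap ℂ (A P) (M.coef I J) := by
  obtain ⟨c, hc⟩ := M.covariant I J
  have : M.coef I J = c := by
    rw [coef, hc, Algebra.algebraMap_eq_smul_one, map_smul, hh.map_one, smul_eq_mul, mul_one]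
  rw [this, hc]

theorem form_smul_psi (hh : IsHaar P h) (a b : A P) (I J : I2) :
    h (M.form (ιA P a • psi P I) (ιA P b • psi P J)) = M.coef I J * h (a * starA P b) := by
  rw [M.form_smul, M.form_psi hh, ← Algebra.commutes, mul_assoc, ← Algebra.smul_def, map_smul,
    smul_eq_mul]

theorem pair_lmulGS (hh : IsHaar P h) (a b : A P) (K N I J : I2) :
    h (M.pair (lmulGS P a (tm P (th P K) (psi P I))) (lmulGS P b (tm P (th P N) (psi P J)))) =
      M.coef I J * gStar P K N * h (a * starA P b) := by
  rw [lmulGS_tm, lmulGS_tm, pair_tm, M.form_psi hh, algebraMap_smul, map_smul, starG_smul,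
    gForm_right, gForm_smul_left, starG_th, gForm_th_starTh, ← Algebra.commutes, mul_assoc,
    ← Algebra.smul_def, map_smul, map_smul, smul_eq_mul, smul_eq_mul, mul_assoc]

theorem coef_compatible (K I J : I2) :
    ∑ L, cliff P K I L * M.coef L J = betaM P K * ∑ L, cliff P (bar K) J L * M.coef I L := by
  have e := M.compatible K (psi P I) (psi P J)
  rw [betaTh_eq, map_smul (ιΓ P), smul_assoc, th_smul_psi, th_smul_psi] at e
  simpa [conj_betaM, conj_cliff, coef] using e

/-- The metric is determined by one of its coefficients. -/
theorem coef_eq (I J : I2) : M.coef I J =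
    if J = opp I then metricRatio P I.2 * M.coef (0, 1) (1, 1) else 0 := by
  have hq := qc_ne P
  have h2 := two_ne P
  have hc : P.c₁ ≠ 0 := P.c₁_ne_zero
  have hk := kappa_ne P
  have c := M.coef_compatible
  -- Instances of the compatibility that suffice to solve for all coefficients. `e1` gives the ratio
  -- κq⁻², since θ₁₁ψ⁺₂ = ψ⁻₁, β(θ₁₁) = −κq⁻³θ₂₂ and θ₂₂ψ⁺₁ = −qψ⁻₂. `e6` and `e7` give symmetry;
  -- the others force zeros, `e15` only together with `e14`.
  have e1 := c (0, 0) (0, 1) (0, 0)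
  have e2 := c (0, 0) (0, 1) (0, 1)
  have e3 := c (0, 0) (0, 1) (1, 1)
  have e4 := c (0, 0) (0, 0) (0, 0)
  have e5 := c (0, 0) (0, 0) (1, 0)
  have e6 := c (1, 0) (1, 1) (1, 1)
  have e7 := c (1, 0) (0, 0) (0, 0)
  have e8 := c (1, 0) (1, 1) (1, 0)
  have e9 := c (1, 0) (1, 1) (0, 1)
  have e10 := c (1, 0) (0, 0) (1, 0)
  have e11 := c (1, 1) (0, 0) (0, 0)
  have e12 := c (1, 1) (0, 0) (1, 0)
  have e13 := c (1, 1) (0, 1) (1, 1)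
  have e14 := c (0, 1) (0, 1) (1, 1)
  have e15 := c (0, 0) (1, 1) (0, 0)
  clear c
  simp [cliff, betaM, bar, hq, h2, hc, hk] at e1 e2 e3 e4 e5 e6 e7 e8 e9 e10 e11 e12 e13 e14 e15
  have e1' : M.coef (1, 0) (0, 0) = ((P.κ : ℤ) : ℂ) * (qc P)⁻¹ ^ 2 * M.coef (0, 1) (1, 1) := by
    rw [e1]
    field_simp
  have e15' : M.coef (0, 0) (0, 0) = 0 := by
    simpa [e14, h2, hc] using e15
  obtain ⟨e, m⟩ := I
  obtain ⟨e', m'⟩ := J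
  fin_cases e <;> fin_cases m <;> fin_cases e' <;> fin_cases m' <;>
    simp [opp, metricRatio, e2, e3, e4, e5, ← e6, ← e7, e8, e9, e10, e11, e12, e13, e14, e15', e1']

end SpinorMetric

/-! ### The Dirac operator -/

theorem theta_eq : theta P = (qhat P)⁻¹ • th P (0, 1) - (qc P / qhat P) • th P (1, 0) := by
  have hs := s_ne P
  simp [theta, Cup, Fintype.sum_prod_type, qc_eq, hs, sq, neg_div, ← sub_eq_add_neg]

theorem starG_theta : starG P (theta P) = -theta P := by
  rw [theta_eq, map_sub, map_smulₛₗ, map_smulₛₗ, starG_th, starG_th]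
  simp only [starTh, conj_qc, conj_qhat, map_inv₀, map_div₀]
  simp
  abel

/-- The scalar `g(θ ⊗ θ)`. -/
def gTheta : ℂ := -(two P * P.c₁) / qhat P ^ 2

/-- The scalar here is the one in `IsHaar.gForm_rmul_theta`; this is why neither D² nor the
Laplacian retains a term quadratic in the action of θ. -/
theorem theta_mul_theta :
    ιΓ P (theta P) * ιΓ P (theta P) = algebraMap ℂ (Cl P) (gTheta P) := by
  have hq := qc_ne P
  have hq' := qhat_ne P
  have e : ιΓ P (theta P) = (qhat P)⁻¹ • clth P 0 1 - (qc P / qhat P) • clth P 1 0 := by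
    simp [theta_eq, clth]
  rw [e]
  simp only [sub_mul, mul_sub, smul_mul_assoc, mul_smul_comm, clth_01_01, clth_10_01, clth_10_10,
    Algebra.algebraMap_eq_smul_one, gTheta]
  match_scalars <;> field_simp <;> ring

/-- The coefficients of `τ(ψ_I ⊗ θ) = ∑ tauCoef I K L θ_K ⊗ ψ_L`. -/
def tauCoef (γ : ℂ) (η : ℤˣ) (I K L : I2) : ℂ :=
  γ / qhat P *
    (if I.1 ≠ L.1 then 0
    else if η = 1 ↔ I.1 = 0 then
      if I.2 ≠ L.2 then 0 else if K = (0, 1) then qc P ^ 3 else if K = (1, 0) then -qc P ^ 4 else 0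
    else if I.2 = 0 then
      if L.2 = 0 then if K = (0, 1) then qc P ^ 2 else if K = (1, 0) then -qc P ^ 5 else 0
      else if K = (0, 0) then qc P ^ 3 - qc P else 0
    else
      if L.2 = 0 then if K = (1, 1) then qc P ^ 2 - qc P ^ 4 else 0
      else if K = (0, 1) then qc P ^ 4
      else if K = (1, 0) then -(qc P - qc P ^ 3 + qc P ^ 5) else 0)

theorem conj_tauCoef {γ : ℂ} (hγ : (starRingEnd ℂ) γ = γ) (η : ℤˣ) (I K L : I2) :
    (starRingEnd ℂ) (tauCoef P γ η I K L) = tauCoef P γ η I K L := by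
  simp only [tauCoef, map_mul, map_div₀, apply_ite (starRingEnd ℂ), map_zero, map_neg, map_sub,
    map_add, map_pow, conj_qc, conj_qhat, hγ]

-- Č^{jk} is supported on j + k = 3, so q^{j+k} contributes q³. When the two powers of R̂ agree (η =
-- 1 on ψ⁺, η = −1 on ψ⁻), Č slides through them and τ(ψ_m ⊗ θ) = γq³ θ ⊗ ψ_m; with opposite powers
-- the spinor index is mixed. Hence the two main cases of `tauCoef`.
set_option maxHeartbeats 4000000 in
theorem sum_tauCoef (γ : ℂ) (η : ℤˣ) (e m r s t : Fin 2) :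
    ∑ J : I2, (P.s * Cup P J.1 J.2 / qhat P) * ∑ l,
      (γ * qc P ^ ((J.1 : ℕ) + (J.2 : ℕ) + 2) *
        (if e = 0 then R P s t l J.2 * Rpow P η r l m J.1
          else Rpow P η s t l J.2 * Rinv P r l m J.1)) =
      tauCoef P γ η (e, m) (r, s) (e, t) := by
  have hs := s_ne P
  have hq' := qhat_ne P
  have h1 : ¬ ((-1 : ℤˣ) = 1) := by decide
  have hq : ∀ x : ℂ, x * P.s ^ 2 = x * qc P := fun x => by rw [qc_eq]
  simp only [Fintype.sum_prod_type, Fin.sum_univ_two, tauCoef]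
  rcases Int.units_eq_one_or η with rfl | rfl <;>
  fin_cases e <;> fin_cases m <;> fin_cases r <;> fin_cases s <;> fin_cases t <;>
    simp [R, Rpow, Rinv, Cup, Cap, h1] <;> field_simp <;>
    simp only [qhat, qc_eq] <;> field_simp <;> ring

theorem sum_tau (γ : ℂ) (η : ℤˣ) (I : I2) :
    ∑ J : I2, (P.s * Cup P J.1 J.2 / qhat P) • tau P γ η I.1 I.2 J =
      ∑ K, ∑ L, tauCoef P γ η I K L • tm P (th P K) (psi P L) := by
  obtain ⟨e, m⟩ := I
  have e1 : ∀ K, ∑ L, tauCoef P γ η (e, m) K L • tm P (th P K) (psi P L) =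
      ∑ t, tauCoef P γ η (e, m) K (e, t) • tm P (th P K) (psi P (e, t)) := by
    intro K
    rw [Fintype.sum_prod_type, Finset.sum_eq_single e]
    · intro e' _ he
      refine Finset.sum_eq_zero fun t _ => ?_
      simp [tauCoef, he.symm]
    · simp
  simp only [e1]
  rw [Fintype.sum_prod_type (f := fun K : I2 => ∑ t, tauCoef P γ η (e, m) K (e, t) •
    tm P (th P K) (psi P (e, t)))]
  simp only [← sum_tauCoef, tau, Finset.smul_sum, Finset.sum_smul, Finset.mul_sum, smul_smul]
  rw [Finset.sum_comm]
  refine Finset.sum_congr rfl fun r _ => ?_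
  rw [Finset.sum_comm]
  refine Finset.sum_congr rfl fun s _ => ?_
  rw [Finset.sum_comm]

/-- The scalars `λ` with `∑ tauCoef I K L θ_K ψ_L = λ ψ_{opp I}`. -/
def diracCoef (γ : ℂ) (η : ℤˣ) (e : Fin 2) : ℂ :=
  γ / qhat P * if e = 0 then (if η = 1 then qc P ^ 2 else qc P ^ 5)
    else (if η = 1 then 1 else qc P ^ 3) * -(qc P * two P * P.c₁)

-- Even where τ mixes the spinor index, Clifford multiplication restores it and only the chirality
-- changes.
set_option maxHeartbeats 1000000 in
theorem sum_tauCoef_mul_cliff (γ : ℂ) (η : ℤˣ) (I J : I2) :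
    ∑ K, ∑ L, tauCoef P γ η I K L * cliff P K L J =
      if J = opp I then diracCoef P γ η I.1 else 0 := by
  have hq := qc_ne P
  have hq' := qhat_ne P
  have h1 : ¬ ((-1 : ℤˣ) = 1) := by decide
  obtain ⟨e, m⟩ := I
  obtain ⟨e', m'⟩ := J
  simp only [Fintype.sum_prod_type, Fin.sum_univ_two]
  rcases Int.units_eq_one_or η with rfl | rfl <;>
  fin_cases e <;> fin_cases m <;> fin_cases e' <;> fin_cases m' <;>
    simp [tauCoef, cliff, opp, diracCoef, h1] <;> field_simp <;>
    first | ring1 | (simp only [qhat]; field_simp; ring1)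

theorem rmul_theta (a : A P) (K : I2) : rmul P (theta P) a K =
    (qhat P)⁻¹ • Phi P a (0, 1) K - (qc P / qhat P) • Phi P a (1, 0) K := by
  simp [theta_eq, ← rmul_th]

-- θ involves only θ₁₂ and θ₂₁, which are fixed by `bar` and have weight β = 1, so the weight of
-- just one index survives.
variable {P} in
theorem IsHaar.mul_star_rmul_theta {h : A P →ₗ[ℂ] ℂ} (hh : IsHaar P h) (a b : A P) (N : I2) :
    h (a * starA P (rmul P (theta P) b N)) =
      betaM P (bar N) * h (rmul P (theta P) a (bar N) * starA P b) := by
  have e1 := hh.Phi_mul_star a b (0, 1) (bar N)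
  have e2 := hh.Phi_mul_star a b (1, 0) (bar N)
  have b1 : bar (0, 1) = (0, 1) := by decide
  have b2 : bar (1, 0) = (1, 0) := by decide
  have b3 : betaM P (0, 1) = 1 := by simp [betaM]
  have b4 : betaM P (1, 0) = 1 := by simp [betaM]
  rw [bar_bar, b1, b3, one_mul] at e1
  rw [bar_bar, b2, b4, one_mul] at e2
  simp only [rmul_theta, map_sub, map_smulₛₗ, map_inv₀, map_div₀, conj_qc, conj_qhat, mul_sub,
    sub_mul, mul_smul_comm, smul_mul_assoc, RingHom.id_apply, ← e1, ← e2, smul_eq_mul]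
  ring

-- By `IsHaar.Phi`, under h the components of θx become those of θ times h(x).
variable {P} in
theorem IsHaar.gForm_rmul_theta {h : A P →ₗ[ℂ] ℂ} (hh : IsHaar P h) (x : A P) :
    h (gForm P (rmul P (theta P) x) (theta P)) = gTheta P * h x := by
  have hq := qc_ne P
  have hq' := qhat_ne P
  have e : ∀ K, gForm P (th P K) (theta P) = algebraMap ℂ (A P)
      ((qhat P)⁻¹ * gco P K (0, 1) - qc P / qhat P * gco P K (1, 0)) := by
    intro K
    simp only [theta_eq, map_sub, map_smul, gForm_th, Algebra.algebraMap_eq_smul_one, smul_smul]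
  have e' : ∀ K, h (rmul P (theta P) x K) = ((qhat P)⁻¹ * (if (0, 1) = K then 1 else 0) -
      qc P / qhat P * (if (1, 0) = K then 1 else 0)) * h x := by
    intro K
    simp only [rmul_theta, map_sub, map_smul, hh.Phi, smul_eq_mul]
    split_ifs <;> ring
  conv_lhs => rw [gam_eq_sum P (rmul P (theta P) x)]
  simp only [map_sum, LinearMap.sum_apply, gForm_smul_left, e, ← Algebra.commutes,
    ← Algebra.smul_def, map_smul, e', smul_eq_mul]
  simp [Fintype.sum_prod_type, gco_val, gTheta]
  field_simp
  simp only [two, qhat]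
  field_simp
  ring

variable {P}
variable {γ : ℂ} {η : ℤˣ} {nab : Sp P →ₗ[ℂ] GS P}

/-- The summand −aθ of da cancels the term aθ coming from a∇ψ_I. -/
theorem IsSpinorConnection.apply_smul_psi (hnab : IsSpinorConnection P γ η nab) (a : A P) (I : I2) :
    nab (ιA P a • psi P I) = tm P (rmul P (theta P) a) (psi P I) -
      ∑ K, ∑ L, tauCoef P γ η I K L • lmulGS P a (tm P (th P K) (psi P L)) := by
  have e := hnab.apply_psi I.1 I.2
  rw [sum_tau P γ η I] at e
  rw [hnab.leibniz, e, dif_apply, map_sub, lmulGS_tm]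
  simp only [map_sum, map_smul]
  have : tm P (rmul P (theta P) a - a • theta P) (psi P I) =
      tm P (rmul P (theta P) a) (psi P I) - tm P (a • theta P) (psi P I) := by
    simp only [tm, TensorProduct.sub_tmul, map_sub]
  rw [this]
  abel

theorem cliffordMul_tm (ρ : Gam P) (φ : Sp P) : cliffordMul P (tm P ρ φ) = ιΓ P ρ • φ := rfl

theorem IsSpinorConnection.dirac_smul_psi (hnab : IsSpinorConnection P γ η nab) (a : A P)
    (I : I2) : dirac nab (ιA P a • psi P I) = ιΓ P (theta P) • (ιA P a • psi P I) -
      diracCoef P γ η I.1 • (ιA P a • psi P (opp I)) := by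
  have e : ∑ K, ∑ L, tauCoef P γ η I K L • cliffordMul P (lmulGS P a (tm P (th P K) (psi P L))) =
      ∑ J, (∑ K, ∑ L, tauCoef P γ η I K L * cliff P K L J) • (ιA P a • psi P J) := by
    simp only [lmulGS_tm, cliffordMul_tm, ιΓ_smul, mul_smul, th_smul_psi, Finset.smul_sum,
      Finset.sum_smul]
    have s : ∀ F : I2 → I2 → I2 → Sp P, ∑ J, ∑ K, ∑ L, F J K L = ∑ K, ∑ L, ∑ J, F J K L := by
      intro F
      rw [Finset.sum_comm]
      exact Finset.sum_congr rfl fun K _ => Finset.sum_comm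
    rw [s fun J K L => tauCoef P γ η I K L • (cliff P K L J • (ιA P a • psi P J))]
    refine Finset.sum_congr rfl fun K _ => Finset.sum_congr rfl fun L _ =>
      Finset.sum_congr rfl fun J _ => ?_
    rw [smul_comm (ιA P a)]
  rw [dirac, LinearMap.comp_apply, hnab.apply_smul_psi, map_sub]
  simp only [map_sum, map_smul]
  rw [e, cliffordMul_tm, ιΓ_rmul, mul_smul]
  simp only [sum_tauCoef_mul_cliff, ite_smul, zero_smul, Finset.sum_ite_eq', Finset.mem_univ,
    if_true]

theorem opp_opp (I : I2) : opp (opp I) = I := by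
  simp [opp]

theorem IsSpinorConnection.dirac_dirac_smul_psi (hnab : IsSpinorConnection P γ η nab) (a : A P)
    (I : I2) : (dirac nab * dirac nab) (ιA P a • psi P I) =
      (gTheta P + diracCoef P γ η I.1 * diracCoef P γ η (1 - I.1)) • (ιA P a • psi P I) -
      ∑ K, ∑ L, (cliff P K I L * diracCoef P γ η L.1) •
        (ιA P (rmul P (theta P) a K) • psi P (opp L)) -
      ∑ K, ∑ L, (diracCoef P γ η I.1 * cliff P K (opp I) L) •
        (ιA P (rmul P (theta P) a K) • psi P L) := by
  -- θ·aψ_I is again a combination of elements bψ_L, so D is known on it; the θ-parts add up to θ².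
  have e : dirac nab (ιΓ P (theta P) • (ιA P a • psi P I)) =
      gTheta P • (ιA P a • psi P I) - ∑ K, ∑ L, (cliff P K I L * diracCoef P γ η L.1) •
        (ιA P (rmul P (theta P) a K) • psi P (opp L)) := by
    rw [← algebraMap_smul (Cl P) (gTheta P), ← theta_mul_theta, mul_smul]
    conv_rhs => rw [ιΓ_smul_ιA_smul_psi P (theta P) a I]
    conv_lhs => rw [ιΓ_smul_ιA_smul_psi P (theta P) a I]
    simp only [map_sum, map_smul, hnab.dirac_smul_psi, smul_sub, Finset.sum_sub_distrib,
      Finset.smul_sum, smul_smul]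
    congr 1
    refine Finset.sum_congr rfl fun K _ => Finset.sum_congr rfl fun L _ => ?_
    rw [smul_comm (ιΓ P (theta P)), ← mul_smul]
  rw [Module.End.mul_apply, hnab.dirac_smul_psi a I, map_sub, e, map_smul, hnab.dirac_smul_psi,
    ιΓ_smul_ιA_smul_psi, opp_opp]
  simp only [smul_sub, Finset.smul_sum, smul_smul, opp, add_smul]
  abel

/-! ### The connection Laplacian -/

variable {h : A P →ₗ[ℂ] ℂ}

theorem SpinorMetric.form_dirac_dirac (hh : IsHaar P h) (M : SpinorMetric P h)
    (hnab : IsSpinorConnection P γ η nab) (a b : A P) (I J : I2) :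
    h (M.form ((dirac nab * dirac nab) (ιA P a • psi P I)) (ιA P b • psi P J)) =
      (gTheta P + diracCoef P γ η I.1 * diracCoef P γ η (1 - I.1)) * M.coef I J *
        h (a * starA P b) -
      ∑ K, (∑ L, cliff P K I L * diracCoef P γ η L.1 * M.coef (opp L) J +
        ∑ L, diracCoef P γ η I.1 * cliff P K (opp I) L * M.coef L J) *
          h (rmul P (theta P) a K * starA P b) := by
  rw [hnab.dirac_dirac_smul_psi]
  simp only [map_sub, map_sum, map_smul, LinearMap.sub_apply, LinearMap.sum_apply,
    LinearMap.smul_apply, M.form_smul_psi hh, smul_eq_mul, add_mul, Finset.sum_mul,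
    Finset.sum_add_distrib, mul_assoc]
  ring

theorem SpinorMetric.pair_nab (hh : IsHaar P h) (M : SpinorMetric P h)
    (hγ : (starRingEnd ℂ) γ = γ) (hnab : IsSpinorConnection P γ η nab) (a b : A P) (I J : I2) :
    h (M.pair (nab (ιA P a • psi P I)) (nab (ιA P b • psi P J))) =
      (-(gTheta P * M.coef I J) + ∑ K, ∑ L, ∑ N, ∑ L', tauCoef P γ η I K L * tauCoef P γ η J N L' *
        (M.coef L L' * gStar P K N)) * h (a * starA P b) -
      ∑ K, (∑ N, ∑ L, tauCoef P γ η J N L * (M.coef I L * gStar P K N) +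
        betaM P K * ∑ N, ∑ L, tauCoef P γ η I N L * (M.coef L J * gStar P N (bar K))) *
          h (rmul P (theta P) a K * starA P b) := by
  -- Since θ^* = −θ and g is balanced, this is −⟨ψ_I, ψ_J⟩ h(g(θ a b^* ⊗ θ)); Haar invariance leaves
  -- only h(a b^*).
  have t1 : h (M.pair (tm P (rmul P (theta P) a) (psi P I)) (tm P (rmul P (theta P) b) (psi P J))) =
      -(gTheta P * M.coef I J) * h (a * starA P b) := by
    rw [M.pair_tm, starG_rmul, starG_theta, M.form_psi hh, algebraMap_smul, smul_neg, smul_neg,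
      map_neg, map_neg, map_smul, map_smul, ← gForm_rmul, ← rmul_mul, hh.gForm_rmul_theta,
      smul_eq_mul]
    ring
  have t2 : h (M.pair (tm P (rmul P (theta P) a) (psi P I))
      (∑ N, ∑ L, tauCoef P γ η J N L • lmulGS P b (tm P (th P N) (psi P L)))) =
      ∑ K, (∑ N, ∑ L, tauCoef P γ η J N L * (M.coef I L * gStar P K N)) *
        h (rmul P (theta P) a K * starA P b) := by
    rw [tm_sum_smul P (rmul P (theta P) a)]
    simp only [map_sum, LinearMap.sum_apply, map_smulₛₗ, conj_tauCoef P hγ, RingHom.id_apply,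
      M.pair_lmulGS hh, smul_eq_mul, Finset.sum_mul, Finset.mul_sum, mul_assoc]
    conv_rhs => rw [Finset.sum_comm]
    exact Finset.sum_congr rfl fun N _ => Finset.sum_comm
  -- Here θ acts on b. It is moved to a by `IsHaar.mul_star_rmul_theta`, which produces β and the
  -- reindexing by `bar`.
  have t3 : h (M.pair (∑ N, ∑ L, tauCoef P γ η I N L • lmulGS P a (tm P (th P N) (psi P L)))
      (tm P (rmul P (theta P) b) (psi P J))) =
      ∑ K, (betaM P K * ∑ N, ∑ L, tauCoef P γ η I N L * (M.coef L J * gStar P N (bar K))) *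
        h (rmul P (theta P) a K * starA P b) := by
    rw [tm_sum_smul P (rmul P (theta P) b),
      Fintype.sum_equiv ⟨bar, bar, bar_bar, bar_bar⟩ (fun K =>
        (betaM P K * ∑ N, ∑ L, tauCoef P γ η I N L * (M.coef L J * gStar P N (bar K))) *
        h (rmul P (theta P) a K * starA P b)) (fun K => (betaM P (bar K) *
          ∑ N, ∑ L, tauCoef P γ η I N L * (M.coef L J * gStar P N K)) *
        h (rmul P (theta P) a (bar K) * starA P b)) (fun K => by simp [bar_bar])]
    simp only [map_sum, LinearMap.sum_apply, LinearMap.smul_apply, map_smul,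
      M.pair_lmulGS hh, smul_eq_mul, Finset.sum_mul, Finset.mul_sum, hh.mul_star_rmul_theta]
    refine Finset.sum_congr rfl fun K _ => Finset.sum_congr rfl fun N _ =>
      Finset.sum_congr rfl fun L _ => ?_
    ring
  have t4 : h (M.pair (∑ K, ∑ L, tauCoef P γ η I K L • lmulGS P a (tm P (th P K) (psi P L)))
      (∑ N, ∑ L, tauCoef P γ η J N L • lmulGS P b (tm P (th P N) (psi P L)))) =
      (∑ K, ∑ L, ∑ N, ∑ L', tauCoef P γ η I K L * tauCoef P γ η J N L' *
        (M.coef L L' * gStar P K N)) * h (a * starA P b) := by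
    simp only [map_sum, LinearMap.sum_apply, LinearMap.smul_apply, map_smulₛₗ, conj_tauCoef P hγ,
      M.pair_lmulGS hh, smul_eq_mul, RingHom.id_apply, Finset.sum_mul, Finset.mul_sum]
    have s : ∀ F : I2 → I2 → I2 → I2 → ℂ, ∑ K, ∑ L, ∑ N, ∑ L', F K L N L' =
        ∑ N, ∑ L', ∑ K, ∑ L, F K L N L' := by
      intro F
      simp only [← Fintype.sum_prod_type']
      exact Fintype.sum_equiv ⟨fun x => (x.2.2.1, x.2.2.2, x.1, x.2.1),
        fun x => (x.2.2.1, x.2.2.2, x.1, x.2.1), fun _ => rfl, fun _ => rfl⟩ _ _ fun _ => rfl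
    rw [s]
    refine Finset.sum_congr rfl fun K _ => Finset.sum_congr rfl fun L _ =>
      Finset.sum_congr rfl fun N _ => Finset.sum_congr rfl fun L' _ => ?_
    ring
  rw [hnab.apply_smul_psi, hnab.apply_smul_psi]
  simp only [map_sub, LinearMap.sub_apply]
  rw [t1, t2, t3, t4]
  simp only [add_mul, Finset.sum_add_distrib]
  ring

end QSL

end

/-! ### The finite identities comparing D² with the Laplacian -/

noncomputable section

namespace QSL

variable (P : Data)

/-- The factor of the connection Laplacian in the comparison with the square of the Dirac
operator. -/
def lapFactor (η : ℤˣ) : ℂ := P.s ^ (1 - 3 * (η : ℤ)) * two P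

/-- The difference between the square of the Dirac operator and the connection Laplacian. -/
def lapConst (γ : ℂ) (η : ℤˣ) : ℂ :=
  ((η : ℤ) : ℂ) * qc P ^ (-(η : ℤ) - 1) * two P * (P.c₁ : ℂ) * ((qc P ^ 3 - 1) / qhat P) *
    ((qc P ^ 6 * γ ^ 2 - 1) / qhat P)

/-- For both signs the exponent 1 − 3η of s is even (−2 or 4), so the square root of q disappears.
-/
theorem lapFactor_one : lapFactor P 1 = (qc P)⁻¹ * two P := by
  have : (1 - 3 * ((1 : ℤˣ) : ℤ)) = -2 := by norm_num
  rw [lapFactor, this, zpow_neg, qc_eq]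
  norm_cast

theorem lapFactor_neg_one : lapFactor P (-1) = qc P ^ 2 * two P := by
  have : (1 - 3 * ((-1 : ℤˣ) : ℤ)) = 4 := by norm_num
  rw [lapFactor, this, qc_eq, ← pow_mul]
  norm_cast

theorem lapFactor_ne (η : ℤˣ) : lapFactor P η ≠ 0 :=
  mul_ne_zero (zpow_ne_zero _ (s_ne P)) (two_ne P)

theorem lapConst_one (γ : ℂ) : lapConst P γ 1 = (qc P ^ 2)⁻¹ * two P * P.c₁ *
    ((qc P ^ 3 - 1) / qhat P) * ((qc P ^ 6 * γ ^ 2 - 1) / qhat P) := by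
  have : (-((1 : ℤˣ) : ℤ) - 1) = -2 := by norm_num
  rw [lapConst, this, zpow_neg]
  norm_cast
  simp

theorem lapConst_neg_one (γ : ℂ) : lapConst P γ (-1) = -(two P * P.c₁ *
    ((qc P ^ 3 - 1) / qhat P) * ((qc P ^ 6 * γ ^ 2 - 1) / qhat P)) := by
  simp [lapConst]

/-- Each row of the matrix g(θ_K ⊗ θ_N^*) has at most two non-zero entries; collapsing the sum
beforehand keeps the case checks below small. -/
theorem sum_mul_gStar (K : I2) (F : I2 → ℂ) (c : ℂ) :
    ∑ N, F N * (c * gStar P K N) = -(c * P.c₁ *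
      if K = (0, 0) then ((P.κ : ℤ) : ℂ) * (qc P)⁻¹ * F (0, 0)
      else if K = (0, 1) then qhat P * F (0, 1) + F (1, 0)
      else if K = (1, 0) then F (0, 1)
      else ((P.κ : ℤ) : ℂ) * qc P ^ 3 * F (1, 1)) := by
  obtain ⟨i, j⟩ := K
  fin_cases i <;> fin_cases j <;>
    simp [Fintype.sum_prod_type, gStar, gco_val, starM, bar] <;> ring

theorem gStar_symm (K N : I2) : gStar P K N = gStar P N K := by
  obtain ⟨i, j⟩ := K
  obtain ⟨r, t⟩ := N
  fin_cases i <;> fin_cases j <;> fin_cases r <;> fin_cases t <;> simp [gStar, gco_val, starM, bar]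

variable {P} {h : A P →ₗ[ℂ] ℂ} (M : SpinorMetric P h) (γ : ℂ) (η : ℤˣ)

theorem SpinorMetric.coef_eq_left (I J : I2) : M.coef I J =
    if I = opp J then metricRatio P J.2 * M.coef (0, 1) (1, 1) else 0 := by
  rw [M.coef_eq]
  by_cases hI : I = opp J
  · rw [hI, opp_opp, if_pos rfl, if_pos rfl]
    rfl
  · rw [if_neg hI, if_neg fun e => hI (by rw [e, opp_opp])]

theorem SpinorMetric.coef_opp (I J : I2) : M.coef (opp I) J =
    if I = J then metricRatio P J.2 * M.coef (0, 1) (1, 1) else 0 := by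
  rw [M.coef_eq, opp_opp]
  by_cases hI : I = J
  · rw [hI, if_pos rfl, if_pos rfl]
    rfl
  · rw [if_neg hI, if_neg (Ne.symm hI)]

-- The coefficients of h((θa)_K b^*), all linear in γ. The factors q + 1 and `lapFactor` are those
-- for which these terms agree.
set_option maxHeartbeats 4000000 in
theorem SpinorMetric.laplace_linear_identity (I J K : I2) :
    (qc P + 1) * (∑ L, cliff P K I L * diracCoef P γ η L.1 * M.coef (opp L) J +
        ∑ L, diracCoef P γ η I.1 * cliff P K (opp I) L * M.coef L J) =
      -(lapFactor P η * (∑ N, ∑ L, tauCoef P γ η J N L * (M.coef I L * gStar P K N) +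
        betaM P K * ∑ N, ∑ L, tauCoef P γ η I N L * (M.coef L J * gStar P N (bar K)))) := by
  have hq := qc_ne P
  have hq' := qhat_ne P
  have h1 : ¬ ((-1 : ℤˣ) = 1) := by decide
  simp only [M.coef_opp]
  simp only [M.coef_eq_left _ J, M.coef_eq I]
  simp only [ite_mul, mul_ite, zero_mul, mul_zero, Finset.sum_ite_eq', Finset.mem_univ,
    if_true, gStar_symm P _ (bar K), sum_mul_gStar]
  generalize M.coef (0, 1) (1, 1) = w
  obtain ⟨e, m⟩ := I
  obtain ⟨e', m'⟩ := J
  obtain ⟨i, j⟩ := K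
  rcases Int.units_eq_one_or η with rfl | rfl <;>
  fin_cases e <;> fin_cases m <;> fin_cases e' <;> fin_cases m' <;> fin_cases i <;> fin_cases j <;>
    simp [cliff, diracCoef, opp, tauCoef, bar, betaM, h1, lapFactor_one, lapFactor_neg_one,
      metricRatio] <;>
    rcases Int.units_eq_one_or P.κ with hk | hk <;> (try simp [hk]) <;> field_simp <;>
    first | ring1 | (simp only [qhat]; field_simp; ring1)

-- The coefficients of h(a b^*), with parts of degree 0 and 2 in γ. In degree 0, after division by
-- g(θ ⊗ θ) and the metric coefficient, it reads (q + 1) − (q − q⁻²) = q⁻¹[2] for η = 1 and (q + 1)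
-- + (q³ − 1) = q²[2] for η = −1.
set_option maxHeartbeats 4000000 in
theorem SpinorMetric.laplace_scalar_identity (I J : I2) :
    (qc P + 1) * ((gTheta P + diracCoef P γ η I.1 * diracCoef P γ η (1 - I.1)) * M.coef I J) -
        lapConst P γ η * M.coef I J =
      -(lapFactor P η * (-(gTheta P * M.coef I J) + ∑ K, ∑ L, ∑ N, ∑ L',
        tauCoef P γ η I K L * tauCoef P γ η J N L' * (M.coef L L' * gStar P K N))) := by
  have hq := qc_ne P
  have hq' := qhat_ne P
  have h1 : ¬ ((-1 : ℤˣ) = 1) := by decide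
  obtain ⟨w, hw⟩ : ∃ w, ∀ I J, M.coef I J = if J = opp I then metricRatio P I.2 * w else 0 :=
    ⟨_, M.coef_eq⟩
  simp only [hw]
  simp only [ite_mul, mul_ite, zero_mul, mul_zero, Finset.sum_ite_eq', Finset.mem_univ,
    if_true, sum_mul_gStar]
  obtain ⟨e, m⟩ := I
  obtain ⟨e', m'⟩ := J
  rcases Int.units_eq_one_or η with rfl | rfl <;>
  fin_cases e <;> fin_cases m <;> fin_cases e' <;> fin_cases m' <;>
    simp [gTheta, diracCoef, opp, tauCoef, h1, lapFactor_one, lapFactor_neg_one,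
      lapConst_one, lapConst_neg_one, metricRatio, Fintype.sum_prod_type] <;>
    rcases Int.units_eq_one_or P.κ with hk | hk <;> (try simp [hk]) <;> field_simp <;>
    first | ring1 | (simp only [qhat, two]; field_simp; ring1)

end QSL

end

/-! ### Existence and uniqueness of the Laplacian, invariance of scalar operators -/

noncomputable section

namespace QSL

variable {P : Data} {h : A P →ₗ[ℂ] ℂ} {γ : ℂ} {η : ℤˣ} {nab : Sp P →ₗ[ℂ] GS P}

/-- The connection Laplacian in terms of the square of the Dirac operator. -/
def connLaplacian (γ : ℂ) (η : ℤˣ) (nab : Sp P →ₗ[ℂ] GS P) : Module.End ℂ (Sp P) :=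
  (lapFactor P η)⁻¹ • ((qc P + 1) • (dirac nab * dirac nab) - lapConst P γ η • 1)

theorem sub_lapFactor_smul_connLaplacian (γ : ℂ) (η : ℤˣ) (nab : Sp P →ₗ[ℂ] GS P) :
    (qc P + 1) • (dirac nab * dirac nab) - lapFactor P η • connLaplacian γ η nab =
      lapConst P γ η • 1 := by
  rw [connLaplacian, smul_smul, mul_inv_cancel₀ (lapFactor_ne P η), one_smul, sub_sub_cancel]

theorem SpinorMetric.form_connLaplacian_smul_psi (hh : IsHaar P h) (M : SpinorMetric P h)
    (hγ : (starRingEnd ℂ) γ = γ) (hnab : IsSpinorConnection P γ η nab) (a b : A P) (I J : I2) :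
    h (M.form (connLaplacian γ η nab (ιA P a • psi P I)) (ιA P b • psi P J)) =
      -h (M.pair (nab (ιA P a • psi P I)) (nab (ιA P b • psi P J))) := by
  have hl := lapFactor_ne P η
  have e1 := M.laplace_scalar_identity γ η I J
  have e2 : (qc P + 1) * ∑ K, (∑ L, cliff P K I L * diracCoef P γ η L.1 * M.coef (opp L) J +
        ∑ L, diracCoef P γ η I.1 * cliff P K (opp I) L * M.coef L J) *
          h (rmul P (theta P) a K * starA P b) =
      -(lapFactor P η * ∑ K, (∑ N, ∑ L, tauCoef P γ η J N L * (M.coef I L * gStar P K N) +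
        betaM P K * ∑ N, ∑ L, tauCoef P γ η I N L * (M.coef L J * gStar P N (bar K))) *
          h (rmul P (theta P) a K * starA P b)) := by
    rw [Finset.mul_sum, Finset.mul_sum, ← Finset.sum_neg_distrib]
    refine Finset.sum_congr rfl fun K _ => ?_
    rw [← mul_assoc, M.laplace_linear_identity γ η I J K, neg_mul, mul_assoc]
  have e3 : h (M.form (connLaplacian γ η nab (ιA P a • psi P I)) (ιA P b • psi P J)) =
      (lapFactor P η)⁻¹ * ((qc P + 1) * h (M.form ((dirac nab * dirac nab) (ιA P a • psi P I))
        (ιA P b • psi P J)) - lapConst P γ η * (M.coef I J * h (a * starA P b))) := by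
    rw [← M.form_smul_psi hh]
    simp only [connLaplacian, LinearMap.smul_apply, LinearMap.sub_apply, map_smul, map_sub,
      smul_eq_mul, Module.End.one_apply]
  rw [e3, M.form_dirac_dirac hh hnab, M.pair_nab hh hγ hnab, inv_mul_eq_iff_eq_mul₀ hl]
  linear_combination h (a * starA P b) * e1 - e2

theorem SpinorMetric.isConnectionLaplacian (hh : IsHaar P h) (M : SpinorMetric P h)
    (hγ : (starRingEnd ℂ) γ = γ) (hnab : IsSpinorConnection P γ η nab) :
    IsConnectionLaplacian M nab (connLaplacian γ η nab) := by
  intro ψ ψ'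
  -- The spanning set is used once per argument: for the linear one with bψ_J fixed, then for the
  -- antilinear one.
  have e : ∀ (b : A P) (J : I2),
      h ∘ₗ M.form.flip (ιA P b • psi P J) ∘ₗ connLaplacian γ η nab =
        -(h ∘ₗ M.pair.flip (nab (ιA P b • psi P J)) ∘ₗ nab) := fun b J =>
    Sp_hom_ext fun a I => M.form_connLaplacian_smul_psi hh hγ hnab a b I J
  have e' : h.comp (M.form (connLaplacian γ η nab ψ)) =
      -(h.comp ((M.pair (nab ψ)).comp nab)) :=
    Sp_hom_ext fun b J => LinearMap.congr_fun (e b J) ψ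
  exact LinearMap.congr_fun e' ψ'

theorem IsConnectionLaplacian.unique {M : SpinorMetric P h} {L L' : Module.End ℂ (Sp P)}
    (hL : IsConnectionLaplacian M nab L) (hL' : IsConnectionLaplacian M nab L') : L' = L := by
  ext1 ψ
  refine sub_eq_zero.1 (M.nondegenerate _ fun ψ' => ?_)
  rw [map_sub, LinearMap.sub_apply, map_sub, hL' ψ ψ', hL ψ ψ', sub_self]

/-! ### Scalar operators are invariant -/

theorem leftAct_counit (a : A P) : leftAct P (counit P).toLinearMap a = a := by
  let F : A P →ₐ[ℂ] A P := (Algebra.TensorProduct.rid ℂ ℂ (A P)).toAlgHom.comp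
    ((Algebra.TensorProduct.map (AlgHom.id ℂ (A P)) (counit P)).comp (comul P))
  change F a = a
  induction a using A_induction with
  | hc c => exact AlgHom.commutes _ _
  | hu i j =>
    simp [F, comul_u, counit_u, -Fin.sum_univ_two]
  | hm a b ha hb => rw [map_mul, ha, hb]
  | ha a b ha hb => rw [map_add, ha, hb]

theorem coaction_smul (c : ℂ) (b : I2 → A P) : coaction P (c • b) = c • coaction P b := by
  simp only [coaction, Pi.smul_apply, map_smul, Finset.smul_sum]

/-- The functionals are p_{JI} = c δ_{JI} ε, multiples of the counit that spans degree zero;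
compatibility with the coaction is just its linearity. -/
theorem isInvariantDiffOp_smul_one (c : ℂ) :
    IsInvariantDiffOp P 0 (c • (1 : Module.End ℂ (Sp P))) := by
  have e : ∀ J I a, leftAct P (if J = I then c • (counit P).toLinearMap else 0) a =
      (c • (Pi.single I a : I2 → A P)) J := by
    intro J I a
    by_cases hJ : J = I
    · subst hJ
      rw [if_pos rfl, Pi.smul_apply, Pi.single_eq_same]
      conv_rhs => rw [← leftAct_counit a]
      simp [leftAct, TensorProduct.map_smul_right]
    · simp [hJ, leftAct]
  refine ⟨fun J I => if J = I then c • (counit P).toLinearMap else 0, ?_, ?_, ?_⟩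
  · intro J I
    dsimp only
    split_ifs
    · exact Submodule.smul_mem _ _ (Submodule.subset_span rfl)
    · exact Submodule.zero_mem _
  · intro I a
    simp only [e]
    rw [Finset.sum_eq_single I]
    · simp [smul_assoc]
    · intro J _ hJ
      simp [hJ]
    · simp
  · intro I a
    simp only [e]
    have hid : TensorProduct.map (c • (1 : Module.End ℂ (Sp P)))
        (LinearMap.id : (ℤ →₀ A P) →ₗ[ℂ] ℤ →₀ A P) = c • LinearMap.id := by
      rw [TensorProduct.map_smul_left, Module.End.one_eq_id, TensorProduct.map_id]
    rw [hid, LinearMap.smul_apply, LinearMap.id_apply, ← coaction_smul]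

end QSL

end

theorem mainTheorem2 (P : QSL.Data) (h : QSL.A P →ₗ[ℂ] ℂ) (hh : QSL.IsHaar P h)
    (M : QSL.SpinorMetric P h) (η : ℤˣ) (γ : ℂ) (hγ : (starRingEnd ℂ) γ = γ)
    (nab : QSL.Sp P →ₗ[ℂ] QSL.GS P) (hnab : QSL.IsSpinorConnection P γ η nab) :
    ∃ L : Module.End ℂ (QSL.Sp P),
      (∀ L' : Module.End ℂ (QSL.Sp P), QSL.IsConnectionLaplacian M nab L' ↔ L' = L) ∧
      (QSL.qc P + 1) • (QSL.dirac nab * QSL.dirac nab) -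
          (P.s ^ (1 - 3 * (η : ℤ)) * QSL.two P) • L =
        (((η : ℤ) : ℂ) * QSL.qc P ^ (-(η : ℤ) - 1) * QSL.two P * (P.c₁ : ℂ) *
          ((QSL.qc P ^ 3 - 1) / QSL.qhat P) *
          ((QSL.qc P ^ 6 * γ ^ 2 - 1) / QSL.qhat P)) • (1 : Module.End ℂ (QSL.Sp P)) ∧
      QSL.IsInvariantDiffOp P 0
        ((QSL.qc P + 1) • (QSL.dirac nab * QSL.dirac nab) -
          (P.s ^ (1 - 3 * (η : ℤ)) * QSL.two P) • L) := by
  have hL := M.isConnectionLaplacian hh hγ hnab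
  have e := QSL.sub_lapFactor_smul_connLaplacian γ η nab
  refine ⟨QSL.connLaplacian γ η nab, fun L' => ⟨hL.unique, fun e' => e' ▸ hL⟩, e, ?_⟩
  exact e ▸ QSL.isInvariantDiffOp_smul_one _
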